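/- Let $(M,g)$ be a compact Riemannian manifold (smooth, Hausdorff, finite-dimensional, without boundary) with Levi-Civita connection $\hat\nabla$, and let $\sigma:M\to\mathbb R$ be a smooth function. Put $A=\mathrm{sym}(d\sigma\otimes g)$, that is, $$A(X,Y,Z)=\tfrac13\big(d\sigma(X)\,g(Y,Z)+d\sigma(Y)\,g(X,Z)+d\sigma(Z)\,g(X,Y)\big).$$ There is a connection $\nabla$ on $M$ with cubic form $A$, i.e. $g(\nabla_XY-\hat\nabla_XY,Z)=A(X,Y,Z)$ for all vector fields $X,Y,Z$. Moreover, for this connection: 1. $(g,\nabla)$ is a statistical structure: $\nabla$ is smooth and torsion-free, and $\nabla g$ is symmetric in all three arguments. 2. $\nabla$ is complete. 3. The dual connection $\overline\nabla$, defined by $X\,g(Y,Z)=g(\nabla_XY,Z)+g(Y,\overline\nabla_XZ)$, exists and is complete. Here a connection is called complete if every geodesic of it (with affine parameter), given on an open interval, extends to a geodesic defined on all of $\mathbb R$. -/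

import Mathlib

open Bundle
open scoped Manifold ContDiff

noncomputable section

namespace StatisticalManifold

section

variable {E : Type*} [NormedAddCommGroup E] [NormedSpace ℝ E] [FiniteDimensional ℝ E]
  {H : Type*} [TopologicalSpace H] {I : ModelWithCorners ℝ E H}
  {M : Type*} [TopologicalSpace M] [ChartedSpace H M]

/-- The velocity `γ'(t)` of a curve `γ` in a manifold. -/
def velocity (I : ModelWithCorners ℝ E H) (γ : ℝ → M) (t : ℝ) : TangentSpace I (γ t) :=
  mfderiv 𝓘(ℝ) I γ t (1 : ℝ)

variable [IsManifold I ∞ M]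

/-- An affine connection `∇` on `M`: a covariant derivative on the tangent bundle, where
`nabla Y x u` is `∇_u Y` for a vector field `Y` and a tangent vector `u` at `x`.  Its values on
vector fields that are not differentiable at `x` carry no meaning and are never used. -/
abbrev Connection (I : ModelWithCorners ℝ E H) (M : Type*) [TopologicalSpace M]
    [ChartedSpace H M] [IsManifold I ∞ M] :=
  CovariantDerivative I E (fun x : M ↦ TangentSpace I x)

/-- `∇` is torsion-free. -/
def IsTorsionFree (nabla : Connection I M) : Prop :=
  haveI : CompleteSpace E := FiniteDimensional.complete ℝ E
  nabla.torsion = 0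

/-- The covariant derivative at time `t`, induced by `∇`, of a vector field `Y` along a curve `γ`.
If `∂ᵢ` are the coordinate fields of the chart at `γ t` and `Y = ∑ Yⁱ ∂ᵢ` along `γ`, this
is `∑ (Yⁱ)'(t) ∂ᵢ + ∑ Yⁱ(t) ∇_{γ'(t)} ∂ᵢ`; here `FiberBundle.extend E (Y t)` is the vector field
`∑ Yⁱ(t) ∂ᵢ` near `γ t`, with constant components. -/
def covDerivAlong (nabla : Connection I M) (γ : ℝ → M)
    (Y : ∀ t, TangentSpace I (γ t)) (t : ℝ) : TangentSpace I (γ t) :=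
  (trivializationAt E (TangentSpace I : M → Type _) (γ t)).symm (γ t)
      (deriv (fun s ↦ (trivializationAt E (TangentSpace I : M → Type _) (γ t)
        (⟨γ s, Y s⟩ : TangentBundle I M)).2) t)
    + nabla (FiberBundle.extend E (Y t)) (γ t) (velocity I γ t)

/-- `γ` is, on the open set `s` of parameters, a geodesic of `∇` with affine parameter:
`∇_{γ'} γ' = 0` on `s`. -/
def IsGeodesicOn (nabla : Connection I M) (γ : ℝ → M) (s : Set ℝ) : Prop :=
  ContMDiffOn 𝓘(ℝ) I 2 γ s ∧
    ∀ t ∈ s, covDerivAlong nabla γ (velocity I γ) t = 0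

/-- `∇` is complete: every geodesic, given on an open interval of its affine parameter, extends to
a geodesic defined on all of `ℝ`. -/
def IsComplete (nabla : Connection I M) : Prop :=
  ∀ (s : Set ℝ) (γ : ℝ → M), IsOpen s → s.OrdConnected → s.Nonempty →
    IsGeodesicOn nabla γ s →
      ∃ δ : ℝ → M, IsGeodesicOn nabla δ Set.univ ∧ Set.EqOn δ γ s

variable [RiemannianBundle (fun x : M ↦ TangentSpace I x)]
  [IsContMDiffRiemannianBundle I ∞ E (fun x : M ↦ TangentSpace I x)]

/-- The covariant derivative of the metric, `(∇g)(u, v, w) = (∇_u g)(v, w)`. -/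
def nablaMetric (nabla : Connection I M) (x : M) (u v w : TangentSpace I x) : ℝ :=
  nabla.derivMetricTensor x v w u

/-- `∇` is a Levi-Civita connection of `g`: torsion-free and metric. -/
def IsLeviCivita (nabla : Connection I M) : Prop :=
  IsTorsionFree nabla ∧
    CovariantDerivative.IsMetricCompatible (V := fun x : M ↦ TangentSpace I x) nabla

/-- `(g, ∇)` is a statistical structure: `∇` is a smooth torsion-free connection and `∇g` is
symmetric in all its arguments (symmetry in the last two holds for every connection). -/
structure IsStatistical (nabla : Connection I M) : Prop where
  smooth : CovariantDerivative.ContMDiffCovariantDerivative nabla ∞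
  torsionFree : IsTorsionFree nabla
  symm₁₂ : ∀ (x : M) (u v w : TangentSpace I x),
    nablaMetric nabla x u v w = nablaMetric nabla x v u w
  symm₂₃ : ∀ (x : M) (u v w : TangentSpace I x),
    nablaMetric nabla x u v w = nablaMetric nabla x u w v

/-- The cubic form of `(g, ∇)` is `A`: `A(X, Y, Z) = g(K(X, Y), Z)`, where
`K(X, Y) = ∇_X Y - ∇̂_X Y` and `∇̂` is the Levi-Civita connection of `g`. -/
def HasCubicForm (nabla : Connection I M)
    (A : ∀ x : M, TangentSpace I x → TangentSpace I x → TangentSpace I x → ℝ) : Prop :=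
  ∃ lc : Connection I M, IsLeviCivita lc ∧
    ∀ (x : M) (u v w : TangentSpace I x),
      A x u v w = inner ℝ (nabla.difference lc x v u) w

/-- `∇'` is dual to `∇` with respect to `g`: `X g(Y, Z) = g(∇_X Y, Z) + g(Y, ∇'_X Z)`. -/
def IsDual (nabla nabla' : Connection I M) : Prop :=
  ∀ (x : M) (u : TangentSpace I x) (Y Z : ∀ y : M, TangentSpace I y),
    MDiffAt (T% Y) x → MDiffAt (T% Z) x →
      d% (fun y : M ↦ inner ℝ (Y y) (Z y)) x u
        = inner ℝ (nabla Y x u) (Z x) + inner ℝ (Y x) (nabla' Z x u)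

/-- Symmetrization of a function of three variables. -/
def sym {V : Type*} (T : V → V → V → ℝ) (u v w : V) : ℝ :=
  (T u v w + T u w v + T v u w + T v w u + T w u v + T w v u) / 6

/-- The symmetric cubic form `sym(dσ ⊗ g)`. -/
def symDerivMetric (σ : M → ℝ) (x : M) : TangentSpace I x → TangentSpace I x →
    TangentSpace I x → ℝ :=
  sym fun u v w ↦ d% σ x u * inner ℝ v w

end

end StatisticalManifold

end

noncomputable section

namespace StatisticalManifold

section Coordinates

variable {E : Type*} [NormedAddCommGroup E] [NormedSpace ℝ E]
  {H : Type*} [TopologicalSpace H] {I : ModelWithCorners ℝ E H}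
  {M : Type*} [TopologicalSpace M] [ChartedSpace H M] [IsManifold I ∞ M]

variable (I) in
/-- The components of a tangent vector at `x` in the chart at `p`. -/
def coord (p x : M) : TangentSpace I x →L[ℝ] E :=
  (trivializationAt E (TangentSpace I : M → Type _) p).continuousLinearMapAt ℝ x

variable (I) in
/-- The tangent vector at `x` with given components in the chart at `p`. -/
def ofCoord (p x : M) : E →L[ℝ] TangentSpace I x :=
  (trivializationAt E (TangentSpace I : M → Type _) p).symmL ℝ x

variable (I) in
/-- The vector field with constant components `a` in the chart at `p`. -/
def coordField (p : M) (a : E) (x : M) : TangentSpace I x :=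
  (trivializationAt E (TangentSpace I : M → Type _) p).symm x a

lemma mem_baseSet_trivializationAt_iff {p x : M} :
    x ∈ (trivializationAt E (TangentSpace I : M → Type _) p).baseSet ↔
      x ∈ (chartAt H p).source := Iff.rfl

lemma coord_apply {p x : M} (hx : x ∈ (chartAt H p).source) (u : TangentSpace I x) :
    coord I p x u =
      (trivializationAt E (TangentSpace I : M → Type _) p (⟨x, u⟩ : TangentBundle I M)).2 := by
  rw [coord, Bundle.Trivialization.continuousLinearMapAt_apply,
    Bundle.Trivialization.coe_linearMapAt_of_mem _ (mem_baseSet_trivializationAt_iff.2 hx)]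

lemma coordField_apply {p x : M} (hx : x ∈ (chartAt H p).source) (a : E) :
    coordField I p a x = ofCoord I p x a :=
  (Bundle.Trivialization.symmL_apply _ (mem_baseSet_trivializationAt_iff.2 hx) a).symm

lemma coord_ofCoord {p x : M} (hx : x ∈ (chartAt H p).source) (a : E) :
    coord I p x (ofCoord I p x a) = a :=
  Bundle.Trivialization.continuousLinearMapAt_symmL _ (mem_baseSet_trivializationAt_iff.2 hx) a

lemma ofCoord_coord {p x : M} (hx : x ∈ (chartAt H p).source) (u : TangentSpace I x) :
    ofCoord I p x (coord I p x u) = u :=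
  Bundle.Trivialization.symmL_continuousLinearMapAt _ (mem_baseSet_trivializationAt_iff.2 hx) u

lemma coord_eq_mfderiv {p x : M} (hx : x ∈ (chartAt H p).source) :
    coord I p x = mfderiv I 𝓘(ℝ, E) (extChartAt I p) x :=
  TangentBundle.continuousLinearMapAt_trivializationAt hx

lemma source_mem_nhds {p x : M} (hx : x ∈ (chartAt H p).source) :
    (chartAt H p).source ∈ nhds x := (chartAt H p).open_source.mem_nhds hx

lemma coord_eventuallyEq {p x : M} (hx : x ∈ (chartAt H p).source)
    (Y : ∀ y : M, TangentSpace I y) :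
    (fun y ↦ coord I p y (Y y)) =ᶠ[nhds x] fun y ↦
      (trivializationAt E (TangentSpace I : M → Type _) p (⟨y, Y y⟩ : TangentBundle I M)).2 := by
  filter_upwards [source_mem_nhds hx] with y hy using coord_apply hy _

lemma contMDiffAt_section_iff_coord {p x : M}
    (hx : x ∈ (chartAt H p).source) (Y : ∀ y : M, TangentSpace I y) :
    CMDiffAt ∞ (T% Y) x ↔ CMDiffAt ∞ (fun y ↦ coord I p y (Y y)) x := by
  rw [(coord_eventuallyEq hx Y).contMDiffAt_iff]
  exact Bundle.Trivialization.contMDiffAt_section_iff _ (mem_baseSet_trivializationAt_iff.2 hx)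

lemma mdifferentiableAt_section_iff_coord {p x : M}
    (hx : x ∈ (chartAt H p).source) (Y : ∀ y : M, TangentSpace I y) :
    MDiffAt (T% Y) x ↔ MDiffAt (fun y ↦ coord I p y (Y y)) x := by
  rw [(coord_eventuallyEq hx Y).mdifferentiableAt_iff]
  exact Bundle.Trivialization.mdifferentiableAt_section_iff I _ _
    (mem_baseSet_trivializationAt_iff.2 hx)

lemma coord_coordField {p x : M} (hx : x ∈ (chartAt H p).source) (a : E) :
    coord I p x (coordField I p a x) = a := by
  rw [coordField_apply hx, coord_ofCoord hx]

lemma coord_coordField_eventuallyEq {p x : M} (hx : x ∈ (chartAt H p).source) (a : E) :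
    (fun y ↦ coord I p y (coordField I p a y)) =ᶠ[nhds x] fun _ ↦ a := by
  filter_upwards [source_mem_nhds hx] with y hy using coord_coordField hy a

lemma contMDiffAt_coordField {p x : M} (hx : x ∈ (chartAt H p).source) (a : E) :
    CMDiffAt ∞ (T% (coordField I p a)) x := by
  rw [contMDiffAt_section_iff_coord hx]
  exact contMDiffAt_const.congr_of_eventuallyEq (coord_coordField_eventuallyEq hx a)

lemma mdifferentiableAt_coordField {p x : M} (hx : x ∈ (chartAt H p).source) (a : E) :
    MDiffAt (T% (coordField I p a)) x :=
  (contMDiffAt_coordField hx a).mdifferentiableAt (by simp)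

lemma extend_eq_coordField {x : M} (u : TangentSpace I x) :
    FiberBundle.extend E u = coordField I x (coord I x x u) := by
  funext y
  rw [coordField, coord_apply (mem_chart_source H x)]
  rfl

lemma coordField_eventuallyEq_mpullback {p x : M} (hx : x ∈ (chartAt H p).source)
    (W : ∀ y : E, TangentSpace 𝓘(ℝ, E) y) (a : E) (hW : ∀ y, W y = a) :
    coordField I p a =ᶠ[nhds x] VectorField.mpullback I 𝓘(ℝ, E) (extChartAt I p) W := by
  filter_upwards [source_mem_nhds hx] with y hy
  rw [VectorField.mpullback_apply, coordField_apply hy]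
  obtain ⟨L, hL⟩ := isInvertible_mfderiv_extChartAt (I := I) (x := p) (y := y)
    (by rwa [extChartAt_source])
  rw [← hL, ContinuousLinearMap.inverse_equiv]
  apply L.injective
  rw [ContinuousLinearEquiv.coe_coe, ContinuousLinearEquiv.apply_symm_apply, hW]
  change (L : TangentSpace I y →L[ℝ] TangentSpace 𝓘(ℝ, E) (extChartAt I p y)) _ = a
  rw [hL, ← coord_eq_mfderiv hy]
  exact coord_ofCoord hy a

lemma mlieBracket_coordField [FiniteDimensional ℝ E] {p x : M}
    (hx : x ∈ (chartAt H p).source) (a b : E) :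
    VectorField.mlieBracket I (coordField I p a) (coordField I p b) x = 0 := by
  have hc : CompleteSpace E := FiniteDimensional.complete ℝ E
  have h2 : IsManifold I (minSmoothness ℝ 3) M := by
    simp only [minSmoothness_of_isRCLikeNormedField]
    infer_instance
  let W (c : E) : ∀ y : E, TangentSpace 𝓘(ℝ, E) y := fun _ ↦ c
  have hW (c : E) (y : E) : MDiffAt (T% (W c)) y := by
    refine ContMDiffAt.mdifferentiableAt (n := 1) ?_ one_ne_zero
    rw [contMDiffAt_vectorSpace_iff_contDiffAt]
    exact contDiffAt_const
  rw [(coordField_eventuallyEq_mpullback hx (W a) a fun _ ↦ rfl).mlieBracket_vectorField_eq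
    (coordField_eventuallyEq_mpullback hx (W b) b fun _ ↦ rfl),
    ← VectorField.mpullback_mlieBracket (n := 2) (hW _ _) (hW _ _)
      (contMDiffAt_extChartAt' hx) (by simp)]
  rw [VectorField.mpullback_apply, ← VectorField.mlieBracketWithin_univ,
    VectorField.mlieBracketWithin_eq_lieBracketWithin, VectorField.lieBracketWithin]
  have h0 (c : E) (y : E) : fderivWithin ℝ (W c) Set.univ y = 0 :=
    fderivWithin_const_apply c
  rw [h0, h0]
  exact (congrArg _ (sub_self (0 : E))).trans (map_zero _)

omit [IsManifold I ∞ M] in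
lemma extChartAt_symm_mem_source {p : M} {y : E} (hy : y ∈ (extChartAt I p).target) :
    (extChartAt I p).symm y ∈ (chartAt H p).source := by
  rw [← extChartAt_source I]
  exact (extChartAt I p).map_target hy

omit [IsManifold I ∞ M] in
lemma extChartAt_mem_target {p x : M} (hx : x ∈ (chartAt H p).source) :
    extChartAt I p x ∈ (extChartAt I p).target :=
  (extChartAt I p).map_source (by rwa [extChartAt_source])

omit [IsManifold I ∞ M] in
lemma extChartAt_symm_extChartAt {p x : M} (hx : x ∈ (chartAt H p).source) :
    (extChartAt I p).symm (extChartAt I p x) = x :=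
  (extChartAt I p).left_inv (by rwa [extChartAt_source])

section Boundaryless

variable [I.Boundaryless]

lemma mvfderiv_eq_fderiv {F : Type*} [NormedAddCommGroup F] [NormedSpace ℝ F] {f : M → F}
    {p x : M} (hx : x ∈ (chartAt H p).source) (hf : MDiffAt f x) :
    d% f x = (fderiv ℝ (f ∘ (extChartAt I p).symm) (extChartAt I p x)) ∘L coord I p x := by
  have hx' : x ∈ (extChartAt I p).source := by rwa [extChartAt_source]
  have hφ : MDiffAt (extChartAt I p) x := mdifferentiableAt_extChartAt hx
  have hψ : MDiffAt (extChartAt I p).symm (extChartAt I p x) :=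
    ((contMDiffOn_extChartAt_symm (n := 1) p).contMDiffAt
      ((isOpen_extChartAt_target p).mem_nhds ((extChartAt I p).map_source hx'))).mdifferentiableAt
      one_ne_zero
  have hg : MDiffAt (f ∘ (extChartAt I p).symm) (extChartAt I p x) := by
    refine MDifferentiableAt.comp _ ?_ hψ
    rwa [(extChartAt I p).left_inv hx']
  have heq : f =ᶠ[nhds x] (f ∘ (extChartAt I p).symm) ∘ extChartAt I p := by
    filter_upwards [source_mem_nhds hx] with y hy
    rw [Function.comp_apply, Function.comp_apply,
      (extChartAt I p).left_inv (by rwa [extChartAt_source])]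
  ext u
  rw [coord_eq_mfderiv hx]
  simp only [mvfderiv]
  rw [heq.mfderiv_eq, mfderiv_comp x hg hφ, mfderiv_eq_fderiv]
  rfl

lemma contDiffAt_comp_extChartAt_symm {F : Type*} [NormedAddCommGroup F] [NormedSpace ℝ F]
    {f : M → F} {p : M} {y : E} (hy : y ∈ (extChartAt I p).target)
    (hf : CMDiffAt ∞ f ((extChartAt I p).symm y)) :
    ContDiffAt ℝ ∞ (f ∘ (extChartAt I p).symm) y := by
  rw [← contMDiffAt_iff_contDiffAt]
  exact hf.comp y ((contMDiffOn_extChartAt_symm p).contMDiffAt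
    ((isOpen_extChartAt_target p).mem_nhds hy))

end Boundaryless

end Coordinates

section Christoffel

variable {E : Type*} [NormedAddCommGroup E] [NormedSpace ℝ E]
  {H : Type*} [TopologicalSpace H] {I : ModelWithCorners ℝ E H}
  {M : Type*} [TopologicalSpace M] [ChartedSpace H M] [IsManifold I ∞ M]

variable (I) in
/-- The flat covariant derivative in the chart at `p`. -/
def flatDeriv (p : M) (Y : ∀ x : M, TangentSpace I x) (x : M) :
    TangentSpace I x →L[ℝ] TangentSpace I x :=
  ofCoord I p x ∘L d% (fun y ↦ coord I p y (Y y)) x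

lemma flatDeriv_add {p x : M} (hx : x ∈ (chartAt H p).source)
    {Y Z : ∀ x : M, TangentSpace I x} (hY : MDiffAt (T% Y) x) (hZ : MDiffAt (T% Z) x) :
    flatDeriv I p (Y + Z) x = flatDeriv I p Y x + flatDeriv I p Z x := by
  rw [mdifferentiableAt_section_iff_coord hx] at hY hZ
  have : (fun y ↦ coord I p y ((Y + Z) y)) =
      (fun y ↦ coord I p y (Y y)) + fun y ↦ coord I p y (Z y) := by
    funext y
    simp
  rw [flatDeriv, this, mvfderiv_add hY hZ, ContinuousLinearMap.comp_add]
  rfl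

lemma flatDeriv_smul {p x : M} (hx : x ∈ (chartAt H p).source)
    {Y : ∀ x : M, TangentSpace I x} {f : M → ℝ} (hY : MDiffAt (T% Y) x) (hf : MDiffAt f x) :
    flatDeriv I p (f • Y) x = f x • flatDeriv I p Y x + (d% f x).smulRight (Y x) := by
  rw [mdifferentiableAt_section_iff_coord hx] at hY
  have : (fun y ↦ coord I p y ((f • Y) y)) = f • fun y ↦ coord I p y (Y y) := by
    funext y
    simp
  rw [flatDeriv, this, mvfderiv_smul hf hY, flatDeriv]
  ext u
  simp [ofCoord_coord hx]

lemma isCovariantDerivativeOn_flatDeriv (p : M) :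
    IsCovariantDerivativeOn E (flatDeriv I p) (chartAt H p).source where
  add hY hZ hx := flatDeriv_add hx hY hZ
  leibniz hY hf hx := flatDeriv_smul hx hY hf

variable [FiniteDimensional ℝ E]

/-- The difference of a connection and the flat connection of the chart at `p`. -/
def christoffel (nabla : Connection I M) (p x : M) :
    TangentSpace I x →L[ℝ] TangentSpace I x →L[ℝ] TangentSpace I x :=
  nabla.isCovariantDerivativeOn.difference (isCovariantDerivativeOn_flatDeriv p) x

lemma eq_flatDeriv_add_christoffel (nabla : Connection I M) {p x : M}
    (hx : x ∈ (chartAt H p).source) {Y : ∀ x : M, TangentSpace I x} (hY : MDiffAt (T% Y) x) :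
    nabla Y x = flatDeriv I p Y x + christoffel nabla p x (Y x) := by
  rw [christoffel, IsCovariantDerivativeOn.difference_apply _ _ hx hY]
  abel

lemma difference_apply (nabla nabla' : Connection I M) {x : M}
    {Y : ∀ x : M, TangentSpace I x} (hY : MDiffAt (T% Y) x) :
    nabla.difference nabla' x (Y x) = nabla Y x - nabla' Y x :=
  IsCovariantDerivativeOn.difference_apply _ _ (Set.mem_univ x) hY

/-- The Christoffel symbols of a connection at `x` in the chart at `p`. -/
def christoffelAt (nabla : Connection I M) (p x : M) : E →L[ℝ] E →L[ℝ] E :=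
  LinearMap.toContinuousBilinearMap <| LinearMap.mk₂ ℝ
    (fun a b ↦ coord I p x (christoffel nabla p x (ofCoord I p x a) (ofCoord I p x b)))
    (by simp) (by simp) (by simp) (by simp)

/-- The Christoffel symbols of a connection in the chart at `p`, as functions of the coordinates. -/
def christoffelCoord (nabla : Connection I M) (p : M) (y : E) : E →L[ℝ] E →L[ℝ] E :=
  christoffelAt nabla p ((extChartAt I p).symm y)

lemma christoffelCoord_apply (nabla : Connection I M) (p : M) (y a b : E) :
    christoffelCoord nabla p y a b = coord I p ((extChartAt I p).symm y)
      (christoffel nabla p ((extChartAt I p).symm y) (ofCoord I p _ a) (ofCoord I p _ b)) := rfl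

lemma christoffel_eq_christoffelCoord (nabla : Connection I M) {p x : M}
    (hx : x ∈ (chartAt H p).source) (u v : TangentSpace I x) :
    coord I p x (christoffel nabla p x u v) =
      christoffelCoord nabla p (extChartAt I p x) (coord I p x u) (coord I p x v) := by
  rw [christoffelCoord_apply, extChartAt_symm_extChartAt hx, ofCoord_coord hx, ofCoord_coord hx]

lemma coord_nabla (nabla : Connection I M) {p x : M}
    (hx : x ∈ (chartAt H p).source) {Y : ∀ x : M, TangentSpace I x} (hY : MDiffAt (T% Y) x)
    (u : TangentSpace I x) :
    coord I p x (nabla Y x u) = d% (fun y ↦ coord I p y (Y y)) x u +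
      christoffelCoord nabla p (extChartAt I p x) (coord I p x (Y x)) (coord I p x u) := by
  rw [eq_flatDeriv_add_christoffel nabla hx hY, ← christoffel_eq_christoffelCoord nabla hx]
  simp [flatDeriv, coord_ofCoord hx]

lemma coord_nabla_coordField (nabla : Connection I M) {p x : M}
    (hx : x ∈ (chartAt H p).source) (a : E) (u : TangentSpace I x) :
    coord I p x (nabla (coordField I p a) x u) =
      christoffelCoord nabla p (extChartAt I p x) a (coord I p x u) := by
  rw [coord_nabla nabla hx (mdifferentiableAt_coordField hx a), coord_coordField hx]
  have : d% (fun y ↦ coord I p y (coordField I p a y)) x = 0 := by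
    rw [mvfderiv, (coord_coordField_eventuallyEq hx a).mfderiv_eq, mfderiv_const]
    exact ContinuousLinearMap.comp_zero _
  rw [this, zero_apply, zero_add]

lemma christoffelCoord_symm {nabla : Connection I M} (h : IsTorsionFree nabla) {p : M} {y : E}
    (hy : y ∈ (extChartAt I p).target) (a b : E) :
    christoffelCoord nabla p y a b = christoffelCoord nabla p y b a := by
  have hc : CompleteSpace E := FiniteDimensional.complete ℝ E
  have hx := extChartAt_symm_mem_source hy
  rw [← (extChartAt I p).right_inv hy]
  set x := (extChartAt I p).symm y
  have h1 := (CovariantDerivative.torsion_eq_zero_iff nabla).1 h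
    (mdifferentiableAt_coordField hx b) (mdifferentiableAt_coordField hx a)
  rw [mlieBracket_coordField hx, sub_eq_zero] at h1
  have h2 := congrArg (coord I p x) h1
  rwa [coord_nabla_coordField nabla hx, coord_nabla_coordField nabla hx, coord_coordField hx,
    coord_coordField hx] at h2

omit [FiniteDimensional ℝ E] in
lemma fderiv_bilinear_apply {F : Type*} [NormedAddCommGroup F] [NormedSpace ℝ F]
    {G : E → E →L[ℝ] E →L[ℝ] F} {y : E} (hG : DifferentiableAt ℝ G y) (a b c : E) :
    fderiv ℝ (fun z ↦ G z b c) y a = fderiv ℝ G y a b c := by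
  rw [((hG.hasFDerivAt.clm_apply (hasFDerivAt_const b y)).clm_apply (hasFDerivAt_const c y)).fderiv]
  simp

section Metric

variable [RiemannianBundle (fun x : M ↦ TangentSpace I x)]

variable (I) in
/-- The components of the metric at `x` in the chart at `p`. -/
def metricAt (p x : M) : E →L[ℝ] E →L[ℝ] ℝ :=
  LinearMap.toContinuousBilinearMap <| LinearMap.mk₂ ℝ
    (fun a b ↦ inner ℝ (ofCoord I p x a) (ofCoord I p x b))
    (by simp [inner_add_left]) (by simp [real_inner_smul_left])
    (by simp [inner_add_right]) (by simp [real_inner_smul_right])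

variable (I) in
/-- The components of the metric in the chart at `p`, as functions of the coordinates. -/
def metricCoord (p : M) (y : E) : E →L[ℝ] E →L[ℝ] ℝ :=
  metricAt I p ((extChartAt I p).symm y)

lemma metricCoord_apply (p : M) (y a b : E) :
    metricCoord I p y a b = inner ℝ (ofCoord I p ((extChartAt I p).symm y) a)
      (ofCoord I p ((extChartAt I p).symm y) b) := rfl

lemma metricCoord_symm (p : M) (y a b : E) : metricCoord I p y a b = metricCoord I p y b a := by
  rw [metricCoord_apply, metricCoord_apply, real_inner_comm]

lemma inner_eq_metricCoord {p x : M} (hx : x ∈ (chartAt H p).source) (u v : TangentSpace I x) :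
    inner ℝ u v = metricCoord I p (extChartAt I p x) (coord I p x u) (coord I p x v) := by
  rw [metricCoord_apply, extChartAt_symm_extChartAt hx, ofCoord_coord hx, ofCoord_coord hx]

variable [IsContMDiffRiemannianBundle I ∞ E (fun x : M ↦ TangentSpace I x)] [I.Boundaryless]

lemma contDiffOn_metricCoord (p : M) :
    ContDiffOn ℝ ∞ (metricCoord I p) (extChartAt I p).target := by
  refine contDiffOn_clm_apply.2 fun a ↦ contDiffOn_clm_apply.2 fun b y hy ↦ ?_
  have hx := extChartAt_symm_mem_source hy
  have h := contDiffAt_comp_extChartAt_symm hy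
    (ContMDiffAt.inner_bundle (E := fun x : M ↦ TangentSpace I x) (contMDiffAt_coordField hx a)
      (contMDiffAt_coordField hx b))
  refine (h.congr_of_eventuallyEq ?_).contDiffWithinAt
  filter_upwards [(isOpen_extChartAt_target p).mem_nhds hy] with z hz
  have hz' := extChartAt_symm_mem_source hz
  rw [metricCoord_apply, Function.comp_apply, coordField_apply hz', coordField_apply hz']

lemma fderiv_metricCoord_apply {p : M} {y : E} (hy : y ∈ (extChartAt I p).target) (a b c : E) :
    fderiv ℝ (fun z ↦ metricCoord I p z b c) y a = fderiv ℝ (metricCoord I p) y a b c :=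
  fderiv_bilinear_apply (((contDiffOn_metricCoord p).contDiffAt
    ((isOpen_extChartAt_target p).mem_nhds hy)).differentiableAt (by simp)) a b c

omit [I.Boundaryless] in
lemma nablaMetric_apply (nabla : Connection I M) {x : M} (u : TangentSpace I x)
    {Y Z : ∀ x : M, TangentSpace I x} (hY : MDiffAt (T% Y) x) (hZ : MDiffAt (T% Z) x) :
    nablaMetric nabla x u (Y x) (Z x) = d% (fun y : M ↦ inner ℝ (Y y) (Z y)) x u
      - inner ℝ (nabla Y x u) (Z x) - inner ℝ (Y x) (nabla Z x u) := by
  have h := CovariantDerivative.derivMetricTensor_apply (V := fun x : M ↦ TangentSpace I x)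
    nabla x (X := FiberBundle.extend E u) hY hZ
  simpa using! h

lemma nablaMetric_eq (nabla : Connection I M) {p x : M} (hx : x ∈ (chartAt H p).source)
    (u v w : TangentSpace I x) :
    nablaMetric nabla x u v w =
      fderiv ℝ (metricCoord I p) (extChartAt I p x) (coord I p x u) (coord I p x v) (coord I p x w)
      - metricCoord I p (extChartAt I p x) (christoffelCoord nabla p (extChartAt I p x)
          (coord I p x v) (coord I p x u)) (coord I p x w)
      - metricCoord I p (extChartAt I p x) (coord I p x v)
          (christoffelCoord nabla p (extChartAt I p x) (coord I p x w) (coord I p x u)) := by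
  have e (u : TangentSpace I x) : coordField I p (coord I p x u) x = u := by
    rw [coordField_apply hx, ofCoord_coord hx]
  have h := nablaMetric_apply nabla u (mdifferentiableAt_coordField hx (coord I p x v))
    (mdifferentiableAt_coordField hx (coord I p x w))
  rw [e, e] at h
  rw [h, inner_eq_metricCoord hx, inner_eq_metricCoord hx, coord_nabla_coordField _ hx,
    coord_nabla_coordField _ hx, mvfderiv_eq_fderiv hx]
  · rw [← fderiv_metricCoord_apply (extChartAt_mem_target hx)]
    congr 2
    rw [ContinuousLinearMap.comp_apply]
    congr 1
    refine Filter.EventuallyEq.fderiv_eq ?_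
    filter_upwards [(isOpen_extChartAt_target p).mem_nhds (extChartAt_mem_target hx)] with z hz
    have hz' := extChartAt_symm_mem_source hz
    rw [metricCoord_apply, Function.comp_apply, coordField_apply hz', coordField_apply hz']
  · exact MDifferentiableAt.inner_bundle (E := fun x : M ↦ TangentSpace I x)
      (mdifferentiableAt_coordField hx _) (mdifferentiableAt_coordField hx _)

end Metric

end Christoffel

section Smoothness

set_option synthInstance.maxHeartbeats 200000 in
lemma contDiffOn_fderiv_bilinear_apply {E F : Type*} [NormedAddCommGroup E] [NormedSpace ℝ E]
    [NormedAddCommGroup F] [NormedSpace ℝ F] {G : E → E →L[ℝ] E →L[ℝ] F} {s : Set E}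
    (hs : IsOpen s) (hG : ContDiffOn ℝ ∞ G s) (a b c : E) :
    ContDiffOn ℝ ∞ (fun y ↦ fderiv ℝ G y a b c) s :=
  (((hG.fderiv_of_isOpen hs (m := ∞) (by simp)).clm_apply contDiffOn_const).clm_apply
    contDiffOn_const).clm_apply contDiffOn_const

lemma contDiffOn_of_nondegenerate {E : Type*} [NormedAddCommGroup E] [NormedSpace ℝ E]
    [FiniteDimensional ℝ E] {G : E → E →L[ℝ] E →L[ℝ] ℝ} {s : Set E} (hs : IsOpen s)
    (hG : ContDiffOn ℝ ∞ G s) (hinj : ∀ y ∈ s, Function.Injective (G y)) {f : E → E}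
    (hf : ∀ c, ContDiffOn ℝ ∞ (fun y ↦ G y (f y) c) s) : ContDiffOn ℝ ∞ f s := by
  intro y hy
  have hc : CompleteSpace E := FiniteDimensional.complete ℝ E
  have hfin : Module.finrank ℝ E = Module.finrank ℝ (E →L[ℝ] ℝ) := by
    rw [← (LinearMap.toContinuousLinearMap (𝕜 := ℝ) (E := E) (F' := ℝ)).finrank_eq]
    exact Subspace.dual_finrank_eq.symm
  have hequiv (z : E) (hz : z ∈ s) : ∃ L : E ≃L[ℝ] (E →L[ℝ] ℝ), (L : E →L[ℝ] E →L[ℝ] ℝ) = G z :=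
    ⟨(LinearMap.linearEquivOfInjective (G z : E →ₗ[ℝ] E →L[ℝ] ℝ) (hinj z hz)
      hfin).toContinuousLinearEquiv, by ext; rfl⟩
  obtain ⟨L, hL⟩ := hequiv y hy
  have h1 : ContDiffAt ℝ ∞ (fun z ↦ ContinuousLinearMap.inverse (G z)) y := by
    refine ContDiffAt.comp y (g := ContinuousLinearMap.inverse) ?_
      (hG.contDiffAt (hs.mem_nhds hy))
    rw [← hL]
    exact contDiffAt_map_inverse L
  have h2 : ContDiffAt ℝ ∞ (fun z ↦ G z (f z)) y :=
    (contDiffOn_clm_apply.2 hf).contDiffAt (hs.mem_nhds hy)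
  refine ((h1.clm_apply h2).congr_of_eventuallyEq ?_).contDiffWithinAt
  filter_upwards [hs.mem_nhds hy] with z hz
  obtain ⟨L', hL'⟩ := hequiv z hz
  rw [← hL', ContinuousLinearMap.inverse_equiv]
  simp

variable {E : Type*} [NormedAddCommGroup E] [NormedSpace ℝ E] [FiniteDimensional ℝ E]
  {H : Type*} [TopologicalSpace H] {I : ModelWithCorners ℝ E H} [I.Boundaryless]
  {M : Type*} [TopologicalSpace M] [ChartedSpace H M] [IsManifold I ∞ M]

lemma contMDiffCovariantDerivative_of_christoffelCoord {nabla : Connection I M}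
    (h : ∀ p, ContDiffOn ℝ ∞ (christoffelCoord nabla p) (extChartAt I p).target) :
    CovariantDerivative.ContMDiffCovariantDerivative nabla ∞ := by
  refine ⟨⟨fun {Y} hY x _ ↦ ContMDiffAt.contMDiffWithinAt ?_⟩⟩
  have hY' : CMDiff ∞ (T% Y) := by simpa [contMDiffOn_univ] using hY
  rw [contMDiffAt_hom_bundle]
  refine ⟨contMDiffAt_id, ?_⟩
  have hx := mem_chart_source H x
  let φ := extChartAt I x
  let f : E → E := (fun y ↦ coord I x y (Y y)) ∘ φ.symm
  have hf (z : E) (hz : z ∈ φ.target) : ContDiffAt ℝ ∞ f z :=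
    contDiffAt_comp_extChartAt_symm hz
      ((contMDiffAt_section_iff_coord (extChartAt_symm_mem_source hz) Y).1 (hY' _))
  let k : E → E →L[ℝ] E := fun z ↦ fderiv ℝ f z + christoffelCoord nabla x z (f z)
  have hφx : φ x ∈ φ.target := extChartAt_mem_target hx
  have hk : ContDiffAt ℝ ∞ k (φ x) := by
    refine ContDiffAt.add ((hf _ hφx).fderiv_right (m := ∞) (by simp)) ?_
    exact ((h x).contDiffAt ((isOpen_extChartAt_target x).mem_nhds hφx)).clm_apply (hf _ hφx)
  have hkφ : CMDiffAt ∞ (k ∘ φ) x := hk.contMDiffAt.comp x contMDiffAt_extChartAt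
  refine hkφ.congr_of_eventuallyEq ?_
  filter_upwards [source_mem_nhds hx] with z hz
  have hYz : MDiffAt (T% Y) z := (hY' z).mdifferentiableAt (by simp)
  ext a
  have h1 : ContinuousLinearMap.inCoordinates E (TangentSpace I : M → Type _) E
      (TangentSpace I : M → Type _) x z x z (nabla Y z) a
      = coord I x z (nabla Y z (ofCoord I x z a)) := rfl
  have h2 : f (φ z) = coord I x z (Y z) := by
    simp only [f, φ, Function.comp_apply]
    rw [extChartAt_symm_extChartAt hz]
  refine h1.trans ?_
  rw [coord_nabla nabla hz hYz, mvfderiv_eq_fderiv hz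
    ((mdifferentiableAt_section_iff_coord hz Y).1 hYz), ContinuousLinearMap.comp_apply,
    coord_ofCoord hz, ← h2]
  rfl

variable [RiemannianBundle (fun x : M ↦ TangentSpace I x)]

omit [I.Boundaryless] in
lemma injective_metricCoord {p : M} {y : E} (hy : y ∈ (extChartAt I p).target) :
    Function.Injective (metricCoord I p y) := by
  refine (injective_iff_map_eq_zero _).2 fun a ha ↦ ?_
  have h : metricCoord I p y a a = 0 := by
    rw [ha]
    rfl
  rw [metricCoord_apply, inner_self_eq_zero] at h
  rw [← coord_ofCoord (I := I) (extChartAt_symm_mem_source hy) a, h, map_zero]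

variable [IsContMDiffRiemannianBundle I ∞ E (fun x : M ↦ TangentSpace I x)]

/-- The Koszul formula in a chart, for a torsion-free connection. -/
lemma two_mul_metricCoord_christoffelCoord {nabla : Connection I M} (h : IsTorsionFree nabla)
    {p : M} {y : E} (hy : y ∈ (extChartAt I p).target) (a b c : E) :
    2 * metricCoord I p y (christoffelCoord nabla p y a b) c =
      fderiv ℝ (metricCoord I p) y a b c + fderiv ℝ (metricCoord I p) y b a c
        - fderiv ℝ (metricCoord I p) y c a b
      - nablaMetric nabla ((extChartAt I p).symm y) (ofCoord I p _ a) (ofCoord I p _ b)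
          (ofCoord I p _ c)
      - nablaMetric nabla ((extChartAt I p).symm y) (ofCoord I p _ b) (ofCoord I p _ a)
          (ofCoord I p _ c)
      + nablaMetric nabla ((extChartAt I p).symm y) (ofCoord I p _ c) (ofCoord I p _ a)
          (ofCoord I p _ b) := by
  have hx := extChartAt_symm_mem_source hy
  simp only [nablaMetric_eq nabla hx, coord_ofCoord hx, (extChartAt I p).right_inv hy]
  rw [christoffelCoord_symm h hy b a, christoffelCoord_symm h hy c a, christoffelCoord_symm h hy c b,
    metricCoord_symm p y (christoffelCoord nabla p y a c) b]
  ring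

lemma contDiffOn_christoffelCoord {nabla : Connection I M} (h : IsTorsionFree nabla) {p : M}
    (hC : ∀ a b c : E, ContDiffOn ℝ ∞ (fun y ↦ nablaMetric nabla ((extChartAt I p).symm y)
      (ofCoord I p _ a) (ofCoord I p _ b) (ofCoord I p _ c)) (extChartAt I p).target) :
    ContDiffOn ℝ ∞ (christoffelCoord nabla p) (extChartAt I p).target := by
  have hs := isOpen_extChartAt_target (I := I) p
  have hD (a b c : E) : ContDiffOn ℝ ∞ (fun y ↦ fderiv ℝ (metricCoord I p) y a b c)
      (extChartAt I p).target :=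
    contDiffOn_fderiv_bilinear_apply hs (contDiffOn_metricCoord p) a b c
  refine contDiffOn_clm_apply.2 fun a ↦ contDiffOn_clm_apply.2 fun b ↦
    contDiffOn_of_nondegenerate hs (contDiffOn_metricCoord p)
      (fun y hy ↦ injective_metricCoord hy) fun c ↦ ?_
  refine ((((((hD a b c).add (hD b a c)).sub (hD c a b)).sub (hC a b c)).sub (hC b a c)).add
    (hC c a b)).const_smul (1 / 2 : ℝ) |>.congr fun y hy ↦ ?_
  have := two_mul_metricCoord_christoffelCoord h hy a b c
  simp only [smul_eq_mul]
  linarith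

end Smoothness

section LeviCivita

set_option synthInstance.maxHeartbeats 200000 in
/-- The algebraic content of the fundamental theorem of Riemannian geometry. -/
lemma exists_symm_bilinear_of_deriv {E : Type*} [NormedAddCommGroup E] [NormedSpace ℝ E]
    [FiniteDimensional ℝ E] (G : E →L[ℝ] E →L[ℝ] ℝ) (hinj : Function.Injective G)
    (hG : ∀ a b, G a b = G b a) (D : E →L[ℝ] E →L[ℝ] E →L[ℝ] ℝ)
    (hD : ∀ a b c, D a b c = D a c b) :
    ∃ B : E →L[ℝ] E →L[ℝ] E, (∀ a b, B a b = B b a) ∧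
      ∀ a b c, D a b c = G (B b a) c + G b (B c a) := by
  have hfin : Module.finrank ℝ E = Module.finrank ℝ (E →L[ℝ] ℝ) := by
    rw [← (LinearMap.toContinuousLinearMap (𝕜 := ℝ) (E := E) (F' := ℝ)).finrank_eq]
    exact Subspace.dual_finrank_eq.symm
  let L := LinearMap.linearEquivOfInjective (G : E →ₗ[ℝ] E →L[ℝ] ℝ) hinj hfin
  have hL (f : E →L[ℝ] ℝ) : G (L.symm f) = f := L.apply_symm_apply f
  have a1 (a a' b c : E) : D (a + a') b c = D a b c + D a' b c := by rw [D.map_add]; rfl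
  have a2 (a b b' c : E) : D a (b + b') c = D a b c + D a b' c := by rw [(D a).map_add]; rfl
  have s1 (r : ℝ) (a b c : E) : D (r • a) b c = r * D a b c := by rw [D.map_smul]; rfl
  have s2 (r : ℝ) (a b c : E) : D a (r • b) c = r * D a b c := by rw [(D a).map_smul]; rfl
  have a3 (a b c c' : E) : D a b (c + c') = D a b c + D a b c' := (D a b).map_add c c'
  have s3 (r : ℝ) (a b c : E) : D a b (r • c) = r * D a b c := (D a b).map_smul r c
  let F (a b : E) : E →L[ℝ] ℝ := (1 / 2 : ℝ) • (D a b + D b a - (D.flip a).flip b)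
  have hF (a b c : E) : F a b c = (1 / 2) * (D a b c + D b a c - D c a b) := rfl
  let S : E →L[ℝ] E →L[ℝ] E := LinearMap.toContinuousBilinearMap <| LinearMap.mk₂ ℝ
    (fun a b ↦ L.symm (F a b))
    (fun a a' b ↦ by
      rw [← map_add]; congr 1; ext c
      rw [add_apply]; simp only [hF, a1, a2]; ring)
    (fun r a b ↦ by
      rw [← map_smul]; congr 1; ext c
      change F (r • a) b c = r * F a b c; simp only [hF, s1, s2]; ring)
    (fun a b b' ↦ by
      rw [← map_add]; congr 1; ext c
      rw [add_apply]; simp only [hF, a1, a2, a3]; ring)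
    (fun r a b ↦ by
      rw [← map_smul]; congr 1; ext c
      change F a (r • b) c = r * F a b c; simp only [hF, s1, s2, s3]; ring)
  have hS (a b c : E) : G (S a b) c = (1 / 2) * (D a b c + D b a c - D c a b) := by
    change G (L.symm _) c = _
    rw [hL, hF]
  refine ⟨S, fun a b ↦ hinj ?_, fun a b c ↦ ?_⟩
  · ext c
    rw [hS, hS, hD c a b]
    ring
  · rw [hG b, hS, hS, hD a c b, hD c b a, hD b c a]
    ring

variable {E : Type*} [NormedAddCommGroup E] [NormedSpace ℝ E] [FiniteDimensional ℝ E]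
  {H : Type*} [TopologicalSpace H] {I : ModelWithCorners ℝ E H}
  {M : Type*} [TopologicalSpace M] [ChartedSpace H M] [IsManifold I ∞ M]

omit [FiniteDimensional ℝ E] in
lemma coordField_coord_self {x : M} (u : TangentSpace I x) :
    coordField I x (coord I x x u) x = u := by
  rw [coordField_apply (mem_chart_source H x), ofCoord_coord (mem_chart_source H x)]

lemma isTorsionFree_iff_christoffelCoord {nabla : Connection I M} : IsTorsionFree nabla ↔
    ∀ (x : M) (a b : E), christoffelCoord nabla x (extChartAt I x x) a b =
      christoffelCoord nabla x (extChartAt I x x) b a := by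
  refine ⟨fun h x ↦ christoffelCoord_symm h (mem_extChartAt_target x), fun h ↦ ?_⟩
  have hc : CompleteSpace E := FiniteDimensional.complete ℝ E
  change nabla.torsion = 0
  funext x
  ext u v
  have hx := mem_chart_source H x
  have key : nabla.torsion x u v = 0 := by
    rw [CovariantDerivative.torsion_apply_eq_extend, extend_eq_coordField, extend_eq_coordField,
      mlieBracket_coordField hx, sub_zero, sub_eq_zero, coordField_coord_self,
      coordField_coord_self, ← ofCoord_coord hx (nabla _ x u), coord_nabla_coordField nabla hx,
      h, ← coord_nabla_coordField nabla hx, ofCoord_coord hx]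
  exact key

lemma christoffelCoord_eq_of_eq_add {nabla : Connection I M} {x : M} {B : E →L[ℝ] E →L[ℝ] E}
    (h : ∀ Y : ∀ x : M, TangentSpace I x, nabla Y x =
      flatDeriv I x Y x + ofCoord I x x ∘L B (coord I x x (Y x)) ∘L coord I x x) :
    christoffelCoord nabla x (extChartAt I x x) = B := by
  have hx := mem_chart_source H x
  ext a b
  have h1 := coord_nabla_coordField nabla hx a (ofCoord I x x b)
  have h2 := eq_flatDeriv_add_christoffel nabla hx (mdifferentiableAt_coordField (I := I) hx a)
  rw [h, add_right_inj] at h2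
  have h3 := congrArg (coord I x x) (DFunLike.congr_fun h2 (ofCoord I x x b))
  rw [christoffel_eq_christoffelCoord nabla hx, coord_coordField hx, coord_ofCoord hx] at h3
  rw [← h3]
  simp [coord_ofCoord hx]

variable [I.Boundaryless] [RiemannianBundle (fun x : M ↦ TangentSpace I x)]
  [IsContMDiffRiemannianBundle I ∞ E (fun x : M ↦ TangentSpace I x)]

omit [I.Boundaryless] in
lemma isMetricCompatible_iff_nablaMetric {nabla : Connection I M} :
    CovariantDerivative.IsMetricCompatible (V := fun x : M ↦ TangentSpace I x) nabla ↔
      ∀ (x : M) (u v w : TangentSpace I x), nablaMetric nabla x u v w = 0 := by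
  constructor
  · intro h x u v w
    rw [nablaMetric, h]
    rfl
  · intro h
    rw [CovariantDerivative.IsMetricCompatible]
    funext x
    ext v w u
    exact h x u v w

lemma fderiv_metricCoord_symm (p : M) (y a b c : E) (hy : y ∈ (extChartAt I p).target) :
    fderiv ℝ (metricCoord I p) y a b c = fderiv ℝ (metricCoord I p) y a c b := by
  rw [← fderiv_metricCoord_apply hy, ← fderiv_metricCoord_apply hy]
  simp only [metricCoord_symm p _ b c]

set_option synthInstance.maxHeartbeats 200000 in
theorem exists_isLeviCivita : ∃ lc : Connection I M, IsLeviCivita lc := by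
  have hB (x : M) := exists_symm_bilinear_of_deriv (metricCoord I x (extChartAt I x x))
    (injective_metricCoord (mem_extChartAt_target x)) (metricCoord_symm x _)
    (fderiv ℝ (metricCoord I x) (extChartAt I x x))
    fun a b c ↦ fderiv_metricCoord_symm x _ a b c (mem_extChartAt_target x)
  choose B hBs hBm using hB
  let lc : Connection I M :=
    { toFun := fun Y x ↦ flatDeriv I x Y x +
        ofCoord I x x ∘L B x (coord I x x (Y x)) ∘L coord I x x
      isCovariantDerivativeOnUniv :=
        { add := fun {Y Z x} hY hZ _ ↦ by
            rw [flatDeriv_add (mem_chart_source H x) hY hZ]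
            ext u
            simp
            abel
          leibniz := fun {Y f x} hY hf _ ↦ by
            rw [flatDeriv_smul (mem_chart_source H x) hY hf]
            ext u
            simp
            abel } }
  have hlc (x : M) : christoffelCoord lc x (extChartAt I x x) = B x :=
    christoffelCoord_eq_of_eq_add fun _ ↦ rfl
  refine ⟨lc, isTorsionFree_iff_christoffelCoord.2 fun x a b ↦ ?_,
    isMetricCompatible_iff_nablaMetric.2 fun x u v w ↦ ?_⟩
  · rw [hlc, hBs]
  · rw [nablaMetric_eq lc (mem_chart_source H x), hlc, hBm]
    ring

end LeviCivita

section CubicForm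

variable {E : Type*} [NormedAddCommGroup E] [NormedSpace ℝ E] [FiniteDimensional ℝ E]
  {H : Type*} [TopologicalSpace H] {I : ModelWithCorners ℝ E H}
  {M : Type*} [TopologicalSpace M] [ChartedSpace H M] [IsManifold I ∞ M]

lemma nabla_extend_eq_add_difference (nabla lc : Connection I M) {x : M} (u v : TangentSpace I x) :
    nabla (FiberBundle.extend E v) x u =
      lc (FiberBundle.extend E v) x u + nabla.difference lc x v u := by
  have h := difference_apply nabla lc
    (FiberBundle.mdifferentiableAt_extend I E v : MDiffAt (T% (FiberBundle.extend E v)) x)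
  rw [FiberBundle.extend_apply_self] at h
  rw [h, sub_apply]
  abel

lemma IsTorsionFree.of_difference {nabla lc : Connection I M} (hlc : IsTorsionFree lc)
    (h : ∀ (x : M) (u v : TangentSpace I x),
      nabla.difference lc x u v = nabla.difference lc x v u) : IsTorsionFree nabla := by
  have hc : CompleteSpace E := FiniteDimensional.complete ℝ E
  change nabla.torsion = 0
  funext x
  ext u v
  have h1 : lc.torsion x u v = 0 := by
    rw [show lc.torsion = 0 from hlc]
    rfl
  have key : nabla.torsion x u v = 0 := by
    rw [CovariantDerivative.torsion_apply_eq_extend] at h1 ⊢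
    simp only [FiberBundle.extend_apply_self] at h1 ⊢
    rw [nabla_extend_eq_add_difference nabla lc, nabla_extend_eq_add_difference nabla lc, h x u v,
      add_sub_add_right_eq_sub, h1]
  exact key

lemma difference_addOneForm (lc : Connection I M)
    (K : ∀ x : M, TangentSpace I x →L[ℝ] TangentSpace I x →L[ℝ] TangentSpace I x) (x : M) :
    CovariantDerivative.difference (lc.addOneForm K) lc x = K x := by
  ext v u
  have h := nabla_extend_eq_add_difference (lc.addOneForm K) lc u v
  have h2 : (lc.addOneForm K) (FiberBundle.extend E v) x u =
      lc (FiberBundle.extend E v) x u + K x (FiberBundle.extend E v x) u := rfl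
  rw [FiberBundle.extend_apply_self] at h2
  exact (add_left_cancel (h2.symm.trans h)).symm

variable [RiemannianBundle (fun x : M ↦ TangentSpace I x)]

omit [FiniteDimensional ℝ E] [IsManifold I ∞ M] in
lemma symDerivMetric_apply (σ : M → ℝ) (x : M) (u v w : TangentSpace I x) :
    symDerivMetric σ x u v w =
      (d% σ x u * inner ℝ v w + d% σ x v * inner ℝ u w + d% σ x w * inner ℝ u v) / 3 := by
  simp only [symDerivMetric, sym]
  rw [real_inner_comm v w, real_inner_comm u w, real_inner_comm u v]
  ring

omit [FiniteDimensional ℝ E] [IsManifold I ∞ M] in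
lemma symDerivMetric_swap₁₂ (σ : M → ℝ) (x : M) (u v w : TangentSpace I x) :
    symDerivMetric σ x u v w = symDerivMetric σ x v u w := by
  rw [symDerivMetric_apply, symDerivMetric_apply, real_inner_comm u v]
  ring

omit [FiniteDimensional ℝ E] [IsManifold I ∞ M] in
lemma symDerivMetric_swap₂₃ (σ : M → ℝ) (x : M) (u v w : TangentSpace I x) :
    symDerivMetric σ x u v w = symDerivMetric σ x u w v := by
  rw [symDerivMetric_apply, symDerivMetric_apply, real_inner_comm v w]
  ring

omit [FiniteDimensional ℝ E] [IsManifold I ∞ M] in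
lemma symDerivMetric_neg (σ : M → ℝ) (x : M) (u v w : TangentSpace I x) :
    symDerivMetric (-σ) x u v w = -symDerivMetric σ x u v w := by
  rw [symDerivMetric_apply, symDerivMetric_apply, mvfderiv_neg]
  simp only [neg_apply]
  ring

variable [IsContMDiffRiemannianBundle I ∞ E (fun x : M ↦ TangentSpace I x)]

lemma nablaMetric_eq_extend (nabla : Connection I M) (x : M) (u v w : TangentSpace I x) :
    nablaMetric nabla x u v w =
      d% (fun y : M ↦ inner ℝ (FiberBundle.extend E v y) (FiberBundle.extend E w y)) x u
        - inner ℝ (nabla (FiberBundle.extend E v) x u) w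
        - inner ℝ v (nabla (FiberBundle.extend E w) x u) := by
  have h := nablaMetric_apply nabla u
    (FiberBundle.mdifferentiableAt_extend I E v : MDiffAt (T% (FiberBundle.extend E v)) x)
    (FiberBundle.mdifferentiableAt_extend I E w : MDiffAt (T% (FiberBundle.extend E w)) x)
  rwa [FiberBundle.extend_apply_self, FiberBundle.extend_apply_self] at h

lemma nablaMetric_eq_sub_difference (nabla lc : Connection I M) (x : M) (u v w : TangentSpace I x) :
    nablaMetric nabla x u v w = nablaMetric lc x u v w
      - inner ℝ (nabla.difference lc x v u) w - inner ℝ (nabla.difference lc x w u) v := by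
  rw [nablaMetric_eq_extend, nablaMetric_eq_extend, nabla_extend_eq_add_difference nabla lc,
    nabla_extend_eq_add_difference nabla lc, inner_add_left, inner_add_right,
    real_inner_comm v (nabla.difference lc x w u)]
  ring

section HasCubicForm

variable {nabla : Connection I M}
  {A : ∀ x : M, TangentSpace I x → TangentSpace I x → TangentSpace I x → ℝ}

lemma HasCubicForm.isTorsionFree (h : HasCubicForm nabla A)
    (hA : ∀ x u v w, A x u v w = A x v u w) : IsTorsionFree nabla := by
  obtain ⟨lc, hlc, hK⟩ := h
  refine hlc.1.of_difference fun x u v ↦ ext_inner_right ℝ fun w ↦ ?_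
  rw [← hK, ← hK, hA]

lemma HasCubicForm.nablaMetric_eq (h : HasCubicForm nabla A)
    (hA : ∀ x u v w, A x u v w = A x u w v) (x : M) (u v w : TangentSpace I x) :
    nablaMetric nabla x u v w = -2 * A x u v w := by
  obtain ⟨lc, hlc, hK⟩ := h
  rw [nablaMetric_eq_sub_difference nabla lc, isMetricCompatible_iff_nablaMetric.1 hlc.2, ← hK,
    ← hK, hA x u w v]
  ring

end HasCubicForm

lemma HasCubicForm.nablaMetric_self {nabla : Connection I M} {σ : M → ℝ}
    (h : HasCubicForm nabla (symDerivMetric σ)) (x : M) (u : TangentSpace I x) :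
    nablaMetric nabla x u u u = -2 * (d% σ x u * inner ℝ u u) := by
  rw [h.nablaMetric_eq (symDerivMetric_swap₂₃ σ), symDerivMetric_apply]
  ring

lemma contDiffOn_symDerivMetric [I.Boundaryless] {σ : M → ℝ} (hσ : ContMDiff I 𝓘(ℝ) ∞ σ) (p : M)
    (a b c : E) :
    ContDiffOn ℝ ∞ (fun y ↦ symDerivMetric σ ((extChartAt I p).symm y) (ofCoord I p _ a)
      (ofCoord I p _ b) (ofCoord I p _ c)) (extChartAt I p).target := by
  have hs := isOpen_extChartAt_target (I := I) p
  have hf : ContDiffOn ℝ ∞ (σ ∘ (extChartAt I p).symm) (extChartAt I p).target :=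
    fun y hy ↦ (contDiffAt_comp_extChartAt_symm hy hσ.contMDiffAt).contDiffWithinAt
  have hd (a : E) : ContDiffOn ℝ ∞ (fun y ↦ fderiv ℝ (σ ∘ (extChartAt I p).symm) y a)
      (extChartAt I p).target :=
    (hf.fderiv_of_isOpen hs (m := ∞) (by simp)).clm_apply contDiffOn_const
  have hg (a b : E) : ContDiffOn ℝ ∞ (fun y ↦ metricCoord I p y a b) (extChartAt I p).target :=
    ((contDiffOn_metricCoord p).clm_apply contDiffOn_const).clm_apply contDiffOn_const
  refine (((((hd a).mul (hg b c)).add ((hd b).mul (hg a c))).add ((hd c).mul (hg a b))).div_const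
    3).congr fun y hy ↦ ?_
  have hx := extChartAt_symm_mem_source hy
  have hdσ (a : E) : d% σ ((extChartAt I p).symm y) (ofCoord I p _ a) =
      fderiv ℝ (σ ∘ (extChartAt I p).symm) y a := by
    rw [mvfderiv_eq_fderiv hx (hσ.mdifferentiable (by simp) _), ContinuousLinearMap.comp_apply,
      coord_ofCoord hx, (extChartAt I p).right_inv hy]
  rw [symDerivMetric_apply, hdσ, hdσ, hdσ]
  rfl

lemma HasCubicForm.contDiffOn_christoffelCoord [I.Boundaryless] {nabla : Connection I M}
    {σ : M → ℝ} (hσ : ContMDiff I 𝓘(ℝ) ∞ σ) (h : HasCubicForm nabla (symDerivMetric σ)) (p : M) :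
    ContDiffOn ℝ ∞ (christoffelCoord nabla p) (extChartAt I p).target := by
  refine StatisticalManifold.contDiffOn_christoffelCoord
    (h.isTorsionFree (symDerivMetric_swap₁₂ σ)) fun a b c ↦ ?_
  simp only [h.nablaMetric_eq (symDerivMetric_swap₂₃ σ)]
  exact contDiffOn_const.mul (contDiffOn_symDerivMetric hσ p a b c)

theorem HasCubicForm.isStatistical [I.Boundaryless] {nabla : Connection I M} {σ : M → ℝ}
    (hσ : ContMDiff I 𝓘(ℝ) ∞ σ) (h : HasCubicForm nabla (symDerivMetric σ)) :
    IsStatistical nabla where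
  smooth := contMDiffCovariantDerivative_of_christoffelCoord (h.contDiffOn_christoffelCoord hσ)
  torsionFree := h.isTorsionFree (symDerivMetric_swap₁₂ σ)
  symm₁₂ x u v w := by
    simp only [h.nablaMetric_eq (symDerivMetric_swap₂₃ σ), symDerivMetric_swap₁₂ σ x u v]
  symm₂₃ x u v w := by
    simp only [h.nablaMetric_eq (symDerivMetric_swap₂₃ σ), symDerivMetric_swap₂₃ σ x u v]

omit [IsManifold I ∞ M] [IsContMDiffRiemannianBundle I ∞ E (fun x : M ↦ TangentSpace I x)] in
lemma exists_inner_eq_symDerivMetric (σ : M → ℝ) (x : M) :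
    ∃ K : TangentSpace I x →L[ℝ] TangentSpace I x →L[ℝ] TangentSpace I x,
      ∀ u v w, inner ℝ (K v u) w = symDerivMetric σ x u v w := by
  have : FiniteDimensional ℝ (TangentSpace I x) := inferInstanceAs (FiniteDimensional ℝ E)
  have : CompleteSpace (TangentSpace I x) := FiniteDimensional.complete ℝ _
  let df : TangentSpace I x →L[ℝ] ℝ := d% σ x
  let grad : TangentSpace I x := (InnerProductSpace.toDual ℝ (TangentSpace I x)).symm df
  have hgrad (w : TangentSpace I x) : inner ℝ grad w = df w :=
    InnerProductSpace.toDual_symm_apply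
  let K := LinearMap.toContinuousBilinearMap <| LinearMap.mk₂ ℝ
    (fun v u : TangentSpace I x ↦
      (1 / 3 : ℝ) • (df u • v + df v • u + (inner ℝ u v : ℝ) • grad))
    (fun v v' u ↦ by rw [map_add, inner_add_right]; module)
    (fun r v u ↦ by rw [map_smul, real_inner_smul_right, smul_eq_mul]; module)
    (fun v u u' ↦ by rw [map_add, inner_add_left]; module)
    (fun r v u ↦ by rw [map_smul, real_inner_smul_left, smul_eq_mul]; module)
  refine ⟨K, fun u v w ↦ ?_⟩
  change inner ℝ ((1 / 3 : ℝ) • (df u • v + df v • u + (inner ℝ u v : ℝ) • grad)) w = _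
  rw [real_inner_smul_left, inner_add_left, inner_add_left, real_inner_smul_left,
    real_inner_smul_left, real_inner_smul_left, hgrad, symDerivMetric_apply]
  ring

omit [IsContMDiffRiemannianBundle I ∞ E (fun x : M ↦ TangentSpace I x)] in
lemma exists_difference_eq_symDerivMetric (lc : Connection I M) (σ : M → ℝ) :
    ∃ nabla : Connection I M, ∀ (x : M) (u v w : TangentSpace I x),
      symDerivMetric σ x u v w = inner ℝ (nabla.difference lc x v u) w := by
  choose K hK using exists_inner_eq_symDerivMetric (I := I) σ
  exact ⟨lc.addOneForm K, fun x u v w ↦ by rw [difference_addOneForm, hK]⟩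

theorem exists_hasCubicForm [I.Boundaryless] (σ : M → ℝ) :
    ∃ nabla : Connection I M, HasCubicForm nabla (symDerivMetric σ) := by
  obtain ⟨lc, hlc⟩ := exists_isLeviCivita (I := I) (M := M)
  obtain ⟨nabla, h⟩ := exists_difference_eq_symDerivMetric lc σ
  exact ⟨nabla, lc, hlc, h⟩

lemma IsLeviCivita.mvfderiv_inner {lc : Connection I M} (hlc : IsLeviCivita lc) {x : M}
    (u : TangentSpace I x) {Y Z : ∀ x : M, TangentSpace I x} (hY : MDiffAt (T% Y) x)
    (hZ : MDiffAt (T% Z) x) :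
    d% (fun y : M ↦ inner ℝ (Y y) (Z y)) x u =
      inner ℝ (lc Y x u) (Z x) + inner ℝ (Y x) (lc Z x u) := by
  have h := nablaMetric_apply lc u hY hZ
  rw [isMetricCompatible_iff_nablaMetric.1 hlc.2] at h
  linarith

theorem HasCubicForm.exists_isDual {nabla : Connection I M} {σ : M → ℝ}
    (h : HasCubicForm nabla (symDerivMetric σ)) : ∃ nabla', IsDual nabla nabla' := by
  obtain ⟨lc, hlc, hK⟩ := h
  obtain ⟨nabla', hK'⟩ := exists_difference_eq_symDerivMetric lc (-σ)
  refine ⟨nabla', fun x u Y Z hY hZ ↦ ?_⟩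
  have h1 := hK x u (Y x) (Z x)
  have h2 := hK' x u (Z x) (Y x)
  rw [difference_apply _ _ hY, sub_apply, inner_sub_left] at h1
  rw [difference_apply _ _ hZ, sub_apply, inner_sub_left, symDerivMetric_neg,
    ← symDerivMetric_swap₂₃, real_inner_comm (Y x), real_inner_comm (Y x)] at h2
  rw [hlc.mvfderiv_inner u hY hZ]
  linarith

theorem HasCubicForm.dual {nabla nabla' : Connection I M} {σ : M → ℝ}
    (h : HasCubicForm nabla (symDerivMetric σ)) (hd : IsDual nabla nabla') :
    HasCubicForm nabla' (symDerivMetric (-σ)) := by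
  obtain ⟨lc, hlc, hK⟩ := h
  refine ⟨lc, hlc, fun x u v w ↦ ?_⟩
  have hv : MDiffAt (T% (FiberBundle.extend E v)) x := FiberBundle.mdifferentiableAt_extend I E v
  have hw : MDiffAt (T% (FiberBundle.extend E w)) x := FiberBundle.mdifferentiableAt_extend I E w
  have h1 := hlc.mvfderiv_inner u hw hv
  rw [hd x u _ _ hw hv, nabla_extend_eq_add_difference nabla lc,
    nabla_extend_eq_add_difference nabla' lc, FiberBundle.extend_apply_self,
    FiberBundle.extend_apply_self, inner_add_left, inner_add_right, ← hK,
    real_inner_comm (nabla'.difference lc x v u) w, symDerivMetric_swap₂₃] at h1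
  rw [symDerivMetric_neg]
  linarith

end CubicForm

section AlongCurve

variable {E : Type*} [NormedAddCommGroup E] [NormedSpace ℝ E]
  {H : Type*} [TopologicalSpace H] {I : ModelWithCorners ℝ E H}
  {M : Type*} [TopologicalSpace M] [ChartedSpace H M]

lemma hasDerivAt_comp_curve {F : Type*} [NormedAddCommGroup F] [NormedSpace ℝ F] {f : M → F}
    {γ : ℝ → M} {t : ℝ} (hf : MDiffAt f (γ t)) (hγ : MDifferentiableAt 𝓘(ℝ) I γ t) :
    HasDerivAt (f ∘ γ) (d% f (γ t) (velocity I γ t)) t := by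
  have h : HasFDerivAt (f ∘ γ) ((d% f (γ t)).comp (mfderiv 𝓘(ℝ) I γ t) : ℝ →L[ℝ] F) t :=
    (hf.hasMFDerivAt.comp t hγ.hasMFDerivAt).hasFDerivAt
  exact h.hasDerivAt

variable [IsManifold I ∞ M]

lemma coord_velocity {p : M} {γ : ℝ → M} {t : ℝ} (hx : γ t ∈ (chartAt H p).source)
    (hγ : MDifferentiableAt 𝓘(ℝ) I γ t) :
    coord I p (γ t) (velocity I γ t) = deriv (extChartAt I p ∘ γ) t := by
  have h : MDiffAt (extChartAt I p) (γ t) :=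
    (contMDiffAt_extChartAt' (n := ∞) hx).mdifferentiableAt (by simp)
  rw [coord_eq_mfderiv hx, (hasDerivAt_comp_curve h hγ).deriv]
  rfl

/-- The coordinate change of the tangent bundle. -/
lemma exists_coord_eq_apply_coord {p q x : M} (hp : x ∈ (chartAt H p).source)
    (hq : x ∈ (chartAt H q).source) : ∃ T : M → E →L[ℝ] E, MDiffAt T x ∧
      ∀ᶠ y in nhds x, ∀ u : TangentSpace I y, coord I q y u = T y (coord I p y u) := by
  refine ⟨fun y ↦ ((trivializationAt E (TangentSpace I : M → Type _) p).coordChangeL ℝ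
    (trivializationAt E (TangentSpace I : M → Type _) q) y : E →L[ℝ] E),
    (contMDiffAt_coordChangeL (n := ∞) (mem_baseSet_trivializationAt_iff.2 hp)
      (mem_baseSet_trivializationAt_iff.2 hq)).mdifferentiableAt (by simp), ?_⟩
  filter_upwards [source_mem_nhds hp, source_mem_nhds hq] with y hyp hyq u
  have h := Bundle.Trivialization.coordChangeL_apply
    (trivializationAt E (TangentSpace I : M → Type _) p)
    (trivializationAt E (TangentSpace I : M → Type _) q) (R := ℝ)
    ⟨mem_baseSet_trivializationAt_iff.2 hyp, mem_baseSet_trivializationAt_iff.2 hyq⟩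
    (coord I p y u)
  rw [ContinuousLinearEquiv.coe_coe, h, coord_apply hyq]
  have h2 : (trivializationAt E (TangentSpace I : M → Type _) p).symm y (coord I p y u) = u := by
    rw [← ofCoord_coord hyp u, coord_ofCoord hyp, ofCoord,
      Bundle.Trivialization.symmL_apply _ (mem_baseSet_trivializationAt_iff.2 hyp)]
  rw [h2]

variable [FiniteDimensional ℝ E]

/-- The covariant derivative along a curve, in an arbitrary chart. -/
lemma coord_covDerivAlong (nabla : Connection I M) {p : M} {γ : ℝ → M} {t : ℝ}
    (hx : γ t ∈ (chartAt H p).source) (hγ : MDifferentiableAt 𝓘(ℝ) I γ t)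
    {Y : ∀ t, TangentSpace I (γ t)}
    (hY : DifferentiableAt ℝ (fun s ↦ coord I p (γ s) (Y s)) t) :
    coord I p (γ t) (covDerivAlong nabla γ Y t) = deriv (fun s ↦ coord I p (γ s) (Y s)) t +
      christoffelCoord nabla p (extChartAt I p (γ t)) (coord I p (γ t) (Y t))
        (coord I p (γ t) (velocity I γ t)) := by
  set q := γ t with hq
  have hxq : γ t ∈ (chartAt H q).source := mem_chart_source H _
  obtain ⟨T, hT, hpq⟩ := exists_coord_eq_apply_coord (I := I) hx hxq
  set b := coord I p (γ t) (Y t) with hb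
  let Z := coordField I p b
  have hZ : MDiffAt (T% Z) (γ t) := mdifferentiableAt_coordField hx b
  have hZx : Z (γ t) = Y t := by
    change coordField I p b (γ t) = Y t
    rw [coordField_apply hx, hb, ofCoord_coord hx]
  have hγc := hγ.continuousAt
  have hTγ := hasDerivAt_comp_curve hT hγ
  -- the components of `Y` at `q`
  have h1 : deriv (fun s ↦ (trivializationAt E (TangentSpace I : M → Type _) (γ t)
        (⟨γ s, Y s⟩ : TangentBundle I M)).2) t = d% T (γ t) (velocity I γ t) b +
          T (γ t) (deriv (fun s ↦ coord I p (γ s) (Y s)) t) := by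
    refine HasDerivAt.deriv (HasDerivAt.congr_of_eventuallyEq (hTγ.clm_apply hY.hasDerivAt) ?_)
    filter_upwards [hγc.eventually hpq, hγc.eventually (source_mem_nhds hxq)] with s hs hs'
    rw [← coord_apply hs', hs]
    rfl
  have h2 : d% (fun y ↦ coord I q y (Z y)) (γ t) (velocity I γ t) =
      d% T (γ t) (velocity I γ t) b := by
    have e : (fun y ↦ coord I q y (Z y)) =ᶠ[nhds (γ t)] fun y ↦ T y b := by
      filter_upwards [hpq, source_mem_nhds hx] with y hy hy'
      rw [hy, coord_coordField hy']
    have hc : MDiffAt (fun y ↦ T y b) (γ t) := hT.clm_apply mdifferentiableAt_const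
    have h3 := hasDerivAt_comp_curve (hc.congr_of_eventuallyEq e) hγ
    have h4 := hTγ.clm_apply (hasDerivAt_const t b)
    have h5 := h3.unique (h4.congr_of_eventuallyEq (hγc.eventually e))
    simpa using h5
  set D := deriv (fun s ↦ coord I p (γ s) (Y s)) t with hD
  have hTx := hpq.self_of_nhds
  have key : covDerivAlong nabla γ Y t =
      ofCoord I p (γ t) D + nabla Z (γ t) (velocity I γ t) := by
    have e1 : covDerivAlong nabla γ Y t =
        ofCoord I q (γ t) (d% T (γ t) (velocity I γ t) b + T (γ t) D) +
          nabla (coordField I q (coord I q (γ t) (Y t))) (γ t) (velocity I γ t) := by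
      rw [covDerivAlong, h1, extend_eq_coordField]
      congr 1
      exact coordField_apply hxq _
    rw [← ofCoord_coord hxq (covDerivAlong nabla γ Y t),
      ← ofCoord_coord hxq (ofCoord I p (γ t) D + nabla Z (γ t) (velocity I γ t))]
    congr 1
    rw [e1, map_add (coord I q (γ t)), map_add (coord I q (γ t)), coord_ofCoord hxq, coord_nabla_coordField nabla hxq,
      coord_nabla nabla hxq hZ, h2, hZx, hTx (ofCoord I p (γ t) D), coord_ofCoord hx]
    abel
  rw [key, map_add, coord_ofCoord hx, coord_nabla_coordField nabla hx]

end AlongCurve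

section GeodesicEquation

variable {E : Type*} [NormedAddCommGroup E] [NormedSpace ℝ E] [FiniteDimensional ℝ E]
  {H : Type*} [TopologicalSpace H] {I : ModelWithCorners ℝ E H}
  {M : Type*} [TopologicalSpace M] [ChartedSpace H M] [IsManifold I ∞ M]

/-- The geodesic vector field in the chart at `p`. -/
def geodesicField (nabla : Connection I M) (p : M) (z : E × E) : E × E :=
  (z.2, -christoffelCoord nabla p z.1 z.2 z.2)

lemma contDiffOn_geodesicField {nabla : Connection I M} {p : M}
    (hΓ : ContDiffOn ℝ ∞ (christoffelCoord nabla p) (extChartAt I p).target) :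
    ContDiffOn ℝ ∞ (geodesicField nabla p) ((extChartAt I p).target ×ˢ Set.univ) := by
  have h : ContDiffOn ℝ ∞ (fun z : E × E ↦ christoffelCoord nabla p z.1)
      ((extChartAt I p).target ×ˢ Set.univ) := hΓ.comp contDiffOn_fst fun z hz ↦ hz.1
  exact contDiffOn_snd.prodMk ((h.clm_apply contDiffOn_snd).clm_apply contDiffOn_snd).neg

omit [FiniteDimensional ℝ E] in
lemma contDiffAt_extChartAt_comp {p : M} {γ : ℝ → M} {t : ℝ} {n : ℕ}
    (hγ : ContMDiffAt 𝓘(ℝ) I n γ t) (hx : γ t ∈ (chartAt H p).source) :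
    ContDiffAt ℝ n (extChartAt I p ∘ γ) t := by
  have h : ContMDiffAt I 𝓘(ℝ, E) n (extChartAt I p) (γ t) :=
    (contMDiffAt_extChartAt' (n := ∞) hx).of_le (by exact_mod_cast le_top)
  exact (h.comp t hγ).contDiffAt

omit [FiniteDimensional ℝ E] in
lemma coord_velocity_eventuallyEq {p : M} {γ : ℝ → M} {t : ℝ}
    (hγ : ContMDiffAt 𝓘(ℝ) I 2 γ t) (hx : γ t ∈ (chartAt H p).source) :
    (fun s ↦ coord I p (γ s) (velocity I γ s)) =ᶠ[nhds t] deriv (extChartAt I p ∘ γ) := by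
  have : IsManifold I 2 M := .of_le (n := ∞) ENat.LEInfty.out
  filter_upwards [(contMDiffAt_iff_contMDiffAt_nhds (by simp)).1 hγ, hγ.continuousAt.eventually (source_mem_nhds hx)]
    with s hs hs'
  exact coord_velocity hs' (hs.mdifferentiableAt (by simp))

lemma covDerivAlong_velocity_eq_zero_iff (nabla : Connection I M) {p : M} {γ : ℝ → M} {t : ℝ}
    (hγ : ContMDiffAt 𝓘(ℝ) I 2 γ t) (hx : γ t ∈ (chartAt H p).source) :
    covDerivAlong nabla γ (velocity I γ) t = 0 ↔
      HasDerivAt (fun s ↦ ((extChartAt I p ∘ γ) s, deriv (extChartAt I p ∘ γ) s))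
        (geodesicField nabla p (extChartAt I p (γ t), deriv (extChartAt I p ∘ γ) t)) t := by
  have hu : ContDiffAt ℝ 2 (extChartAt I p ∘ γ) t := contDiffAt_extChartAt_comp hγ hx
  have hu' : DifferentiableAt ℝ (deriv (extChartAt I p ∘ γ)) t :=
    (hu.derivWithin (m := 1) (by norm_num)).differentiableAt (by simp)
  have hv := coord_velocity_eventuallyEq hγ hx
  have hY : DifferentiableAt ℝ (fun s ↦ coord I p (γ s) (velocity I γ s)) t :=
    hu'.congr_of_eventuallyEq hv
  have h1 := coord_covDerivAlong nabla hx (hγ.mdifferentiableAt (by simp)) hY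
  rw [hv.deriv_eq, coord_velocity hx (hγ.mdifferentiableAt (by simp))] at h1
  have h2 : covDerivAlong nabla γ (velocity I γ) t = 0 ↔
      coord I p (γ t) (covDerivAlong nabla γ (velocity I γ) t) = 0 := by
    refine ⟨fun h ↦ by rw [h, map_zero], fun h ↦ ?_⟩
    rw [← ofCoord_coord hx (covDerivAlong nabla γ (velocity I γ) t), h, map_zero]
  rw [h2, h1]
  have h3 := (hu.differentiableAt (by simp)).hasDerivAt.prodMk hu'.hasDerivAt
  refine ⟨fun h ↦ ?_, fun h ↦ ?_⟩
  · rw [eq_neg_of_add_eq_zero_left h] at h3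
    exact h3
  · have h4 := congrArg Prod.snd (h3.unique h)
    exact eq_neg_iff_add_eq_zero.1 h4

lemma IsGeodesicOn.hasDerivAt {nabla : Connection I M} {γ : ℝ → M} {s : Set ℝ}
    (h : IsGeodesicOn nabla γ s) (hs : IsOpen s) {t : ℝ} (ht : t ∈ s) {p : M}
    (hx : γ t ∈ (chartAt H p).source) :
    HasDerivAt (fun s ↦ ((extChartAt I p ∘ γ) s, deriv (extChartAt I p ∘ γ) s))
      (geodesicField nabla p (extChartAt I p (γ t), deriv (extChartAt I p ∘ γ) t)) t :=
  (covDerivAlong_velocity_eq_zero_iff nabla (h.1.contMDiffAt (hs.mem_nhds ht)) hx).1 (h.2 t ht)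

lemma contDiffOn_two_of_hasDerivAt {F : Type*} [NormedAddCommGroup F] [NormedSpace ℝ F]
    {f : F → F} {Ω : Set F} (hf : ContDiffOn ℝ 1 f Ω) {α : ℝ → F} {J : Set ℝ} (hJ : IsOpen J)
    (hα : ∀ t ∈ J, α t ∈ Ω ∧ HasDerivAt α (f (α t)) t) : ContDiffOn ℝ 2 α J := by
  have hd : DifferentiableOn ℝ α J := fun t ht ↦
    (hα t ht).2.differentiableAt.differentiableWithinAt
  have hderiv : Set.EqOn (deriv α) (f ∘ α) J := fun t ht ↦ (hα t ht).2.deriv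
  have hmaps : Set.MapsTo α J Ω := fun t ht ↦ (hα t ht).1
  have h1 : ContDiffOn ℝ (0 + 1) α J :=
    (contDiffOn_succ_iff_deriv_of_isOpen hJ).2 ⟨hd, by simp, contDiffOn_zero.2
      ((hf.continuousOn.comp hd.continuousOn hmaps).congr hderiv)⟩
  rw [zero_add] at h1
  have h2 : ContDiffOn ℝ (1 + 1) α J :=
    (contDiffOn_succ_iff_deriv_of_isOpen hJ).2 ⟨hd, by simp, (hf.comp h1 hmaps).congr hderiv⟩
  rwa [one_add_one_eq_two] at h2

variable [I.Boundaryless]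

lemma isGeodesicOn_of_hasDerivAt {nabla : Connection I M} {p : M}
    (hΓ : ContDiffOn ℝ ∞ (christoffelCoord nabla p) (extChartAt I p).target)
    {α : ℝ → E × E} {J : Set ℝ} (hJ : IsOpen J)
    (hα : ∀ t ∈ J, (α t).1 ∈ (extChartAt I p).target ∧
      HasDerivAt α (geodesicField nabla p (α t)) t) :
    IsGeodesicOn nabla (fun t ↦ (extChartAt I p).symm (α t).1) J := by
  have h2 : ContDiffOn ℝ 2 α J := contDiffOn_two_of_hasDerivAt
    ((contDiffOn_geodesicField hΓ).of_le (by exact_mod_cast le_top)) hJ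
    fun t ht ↦ ⟨⟨(hα t ht).1, Set.mem_univ _⟩, (hα t ht).2⟩
  have hγ (t : ℝ) (ht : t ∈ J) :
      ContMDiffAt 𝓘(ℝ) I 2 (fun t ↦ (extChartAt I p).symm (α t).1) t := by
    have h3 : ContMDiffAt 𝓘(ℝ, E) I 2 (extChartAt I p).symm (α t).1 :=
      ((contMDiffOn_extChartAt_symm p).contMDiffAt
        ((isOpen_extChartAt_target p).mem_nhds (hα t ht).1)).of_le
          (show (2 : WithTop ℕ∞) ≤ ∞ from ENat.LEInfty.out)
    have h4 : ContMDiffAt 𝓘(ℝ) 𝓘(ℝ, E) 2 (fun t ↦ (α t).1) t :=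
      (contDiffAt_fst.comp t (h2.contDiffAt (hJ.mem_nhds ht))).contMDiffAt
    exact h3.comp t h4
  refine ⟨fun t ht ↦ (hγ t ht).contMDiffWithinAt, fun t ht ↦ ?_⟩
  have hx := extChartAt_symm_mem_source (hα t ht).1
  have e : Set.EqOn (extChartAt I p ∘ fun t ↦ (extChartAt I p).symm (α t).1)
      (fun t ↦ (α t).1) J := fun s hs ↦ (extChartAt I p).right_inv (hα s hs).1
  have hd (t : ℝ) (ht : t ∈ J) : HasDerivAt (fun t ↦ (α t).1) (α t).2 t :=
    (hasFDerivAt_fst.comp_hasDerivAt t (hα t ht).2 :)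
  have e' : Set.EqOn (deriv (extChartAt I p ∘ fun t ↦ (extChartAt I p).symm (α t).1))
      (fun t ↦ (α t).2) J := fun s hs ↦ by
    rw [(e.eventuallyEq_of_mem (hJ.mem_nhds hs)).deriv_eq, (hd s hs).deriv]
  rw [covDerivAlong_velocity_eq_zero_iff nabla (hγ t ht) hx, e' ht,
    (extChartAt I p).right_inv (hα t ht).1]
  refine (hα t ht).2.congr_of_eventuallyEq ?_
  filter_upwards [hJ.mem_nhds ht] with s hs
  rw [e hs, e' hs]

end GeodesicEquation

section LocalSolutions

open Metric

variable {F : Type*} [NormedAddCommGroup F] [NormedSpace ℝ F]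

lemma eventually_exists_hasDerivAt_mem [CompleteSpace F] {f : F → F} {x₀ : F}
    (hf : ContDiffAt ℝ 1 f x₀) {Ω : Set F} (hΩ : Ω ∈ nhds x₀) :
    ∃ ε > (0 : ℝ), ∀ᶠ x in nhds x₀, ∃ α : ℝ → F, α 0 = x ∧
      ∀ t ∈ Set.Ioo (-ε) ε, α t ∈ Ω ∧ HasDerivAt α (f (α t)) t := by
  obtain ⟨ε, hε, a, r, L, K, hr, hpl⟩ := IsPicardLindelof.of_contDiffAt_one hf
  obtain ⟨α, hα, hc⟩ := (hpl 0).exists_forall_mem_closedBall_eq_hasDerivWithinAt_continuousOn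
  simp only [zero_sub, zero_add] at hα hc
  have h0 : closedBall x₀ r ×ˢ Set.Icc (-ε) ε ∈ nhds (x₀, (0 : ℝ)) :=
    prod_mem_nhds (closedBall_mem_nhds x₀ hr) (Icc_mem_nhds (by linarith) hε)
  have h1 : α (x₀, 0) = x₀ := (hα x₀ (mem_closedBall_self hr.le)).1
  have h2 : ∀ᶠ z in nhds (x₀, (0 : ℝ)), α z ∈ Ω :=
    (hc.continuousAt h0).eventually_mem (by rwa [h1])
  obtain ⟨u, hu, v, hv, huv⟩ := mem_nhds_prod_iff.1 h2
  obtain ⟨δ, hδ, hδv⟩ := Metric.mem_nhds_iff.1 hv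
  refine ⟨min ε δ, lt_min hε hδ, ?_⟩
  filter_upwards [hu, closedBall_mem_nhds x₀ hr] with x hx hx'
  refine ⟨fun t ↦ α (x, t), (hα x hx').1, fun t ht ↦ ?_⟩
  have ht1 : t ∈ Set.Ioo (-ε) ε :=
    ⟨by linarith [ht.1, min_le_left ε δ], ht.2.trans_le (min_le_left _ _)⟩
  refine ⟨huv ⟨hx, hδv ?_⟩, ?_⟩
  · rw [Real.ball_eq_Ioo, zero_sub, zero_add]
    exact ⟨by linarith [ht.1, min_le_right ε δ], ht.2.trans_le (min_le_right _ _)⟩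
  · exact ((hα x hx').2 t (Set.Ioo_subset_Icc_self ht1)).hasDerivAt (Icc_mem_nhds ht1.1 ht1.2)

/-- Solutions of an ordinary differential equation starting in a compact set exist for a time that
is bounded below. -/
lemma exists_forall_mem_isCompact_hasDerivAt [CompleteSpace F] {f : F → F} {Ω : Set F}
    (hΩ : IsOpen Ω) (hf : ContDiffOn ℝ 1 f Ω) {K : Set F} (hK : IsCompact K) (hKΩ : K ⊆ Ω) :
    ∃ ε > (0 : ℝ), ∀ x ∈ K, ∃ α : ℝ → F, α 0 = x ∧
      ∀ t ∈ Set.Ioo (-ε) ε, α t ∈ Ω ∧ HasDerivAt α (f (α t)) t := by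
  refine hK.induction_on (p := fun K ↦ ∃ ε > (0 : ℝ), ∀ x ∈ K, ∃ α : ℝ → F, α 0 = x ∧
      ∀ t ∈ Set.Ioo (-ε) ε, α t ∈ Ω ∧ HasDerivAt α (f (α t)) t) ?_ ?_ ?_ ?_
  · exact ⟨1, one_pos, fun x hx ↦ hx.elim⟩
  · rintro s t hst ⟨ε, hε, h⟩
    exact ⟨ε, hε, fun x hx ↦ h x (hst hx)⟩
  · rintro s t ⟨ε, hε, h⟩ ⟨δ, hδ, h'⟩
    refine ⟨min ε δ, lt_min hε hδ, ?_⟩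
    rintro x (hx | hx)
    · obtain ⟨α, h1, h2⟩ := h x hx
      exact ⟨α, h1, fun t ht ↦ h2 t
        ⟨by linarith [ht.1, min_le_left ε δ], ht.2.trans_le (min_le_left _ _)⟩⟩
    · obtain ⟨α, h1, h2⟩ := h' x hx
      exact ⟨α, h1, fun t ht ↦ h2 t
        ⟨by linarith [ht.1, min_le_right ε δ], ht.2.trans_le (min_le_right _ _)⟩⟩
  · intro x hx
    have hx' := hΩ.mem_nhds (hKΩ hx)
    obtain ⟨ε, hε, h⟩ := eventually_exists_hasDerivAt_mem (hf.contDiffAt hx') hx'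
    exact ⟨_, mem_nhdsWithin_of_mem_nhds h, ε, hε, fun y hy ↦ hy⟩

lemma eventuallyEq_of_hasDerivAt {f : F → F} {t₀ : ℝ} {α β : ℝ → F}
    (hf : ContDiffAt ℝ 1 f (α t₀)) (hα : ∀ᶠ t in nhds t₀, HasDerivAt α (f (α t)) t)
    (hβ : ∀ᶠ t in nhds t₀, HasDerivAt β (f (β t)) t) (h : α t₀ = β t₀) : α =ᶠ[nhds t₀] β := by
  obtain ⟨K, s, hs, hl⟩ := hf.exists_lipschitzOnWith
  refine ODE_solution_unique_of_eventually (v := fun _ ↦ f) (s := fun _ ↦ s)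
    (Filter.Eventually.of_forall fun _ ↦ hl) ?_ ?_ h
  · filter_upwards [hα, hα.self_of_nhds.continuousAt.eventually_mem hs] with t h1 h2
      using ⟨h1, h2⟩
  · rw [h] at hs
    filter_upwards [hβ, hβ.self_of_nhds.continuousAt.eventually_mem hs] with t h1 h2
      using ⟨h1, h2⟩

end LocalSolutions

section Geodesics

variable {E : Type*} [NormedAddCommGroup E] [NormedSpace ℝ E] [FiniteDimensional ℝ E]
  {H : Type*} [TopologicalSpace H] {I : ModelWithCorners ℝ E H}
  {M : Type*} [TopologicalSpace M] [ChartedSpace H M] [IsManifold I ∞ M]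

omit [FiniteDimensional ℝ E] in
lemma IsGeodesicOn.mono {nabla : Connection I M} {γ : ℝ → M} {s t : Set ℝ}
    (h : IsGeodesicOn nabla γ t) (hst : s ⊆ t) : IsGeodesicOn nabla γ s :=
  ⟨h.1.mono hst, fun r hr ↦ h.2 r (hst hr)⟩

omit [FiniteDimensional ℝ E] in
lemma IsGeodesicOn.contMDiffAt {nabla : Connection I M} {γ : ℝ → M} {s : Set ℝ}
    (h : IsGeodesicOn nabla γ s) (hs : IsOpen s) {t : ℝ} (ht : t ∈ s) :
    ContMDiffAt 𝓘(ℝ) I 2 γ t := h.1.contMDiffAt (hs.mem_nhds ht)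

lemma IsGeodesicOn.congr {nabla : Connection I M} {γ δ : ℝ → M} {s : Set ℝ}
    (h : IsGeodesicOn nabla γ s) (hs : IsOpen s) (hδ : Set.EqOn δ γ s) :
    IsGeodesicOn nabla δ s := by
  refine ⟨h.1.congr hδ, fun t ht ↦ ?_⟩
  have e : δ =ᶠ[nhds t] γ := hδ.eventuallyEq_of_mem (hs.mem_nhds ht)
  have hγ := h.contMDiffAt hs ht
  have hx : γ t ∈ (chartAt H (γ t)).source := mem_chart_source H _
  have hx' : δ t ∈ (chartAt H (γ t)).source := by rwa [hδ ht]
  have e1 : extChartAt I (γ t) ∘ δ =ᶠ[nhds t] extChartAt I (γ t) ∘ γ :=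
    e.mono fun s hs ↦ congrArg (extChartAt I (γ t)) hs
  rw [covDerivAlong_velocity_eq_zero_iff nabla (hγ.congr_of_eventuallyEq e) hx', hδ ht,
    e1.deriv_eq]
  exact (h.hasDerivAt hs ht hx).congr_of_eventuallyEq (e1.prodMk e1.deriv)

lemma isGeodesicOn_of_forall_exists {nabla : Connection I M} {γ : ℝ → M} {s : Set ℝ}
    (h : ∀ t ∈ s, ∃ δ : ℝ → M, ∃ u : Set ℝ, IsOpen u ∧ t ∈ u ∧ IsGeodesicOn nabla δ u ∧
      Set.EqOn γ δ u) : IsGeodesicOn nabla γ s := by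
  refine ⟨fun t ht ↦ ?_, fun t ht ↦ ?_⟩ <;> obtain ⟨δ, u, hu, htu, hδ, e⟩ := h t ht
  · exact ((hδ.congr hu e).contMDiffAt hu htu).contMDiffWithinAt
  · exact (hδ.congr hu e).2 t htu

variable [I.Boundaryless]

/-- Two geodesics with the same position and velocity at some time agree near that time. -/
lemma IsGeodesicOn.eventuallyEq {nabla : Connection I M}
    (hΓ : ∀ p, ContDiffOn ℝ ∞ (christoffelCoord nabla p) (extChartAt I p).target)
    {γ δ : ℝ → M} {s s' : Set ℝ} (hγ : IsGeodesicOn nabla γ s) (hδ : IsGeodesicOn nabla δ s')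
    (hs : IsOpen s) (hs' : IsOpen s') {t : ℝ} (ht : t ∈ s) (ht' : t ∈ s') {p : M}
    (hx : γ t ∈ (chartAt H p).source) (h0 : γ t = δ t)
    (h1 : deriv (extChartAt I p ∘ γ) t = deriv (extChartAt I p ∘ δ) t) : γ =ᶠ[nhds t] δ := by
  have hx' : δ t ∈ (chartAt H p).source := h0 ▸ hx
  have hcγ := (hγ.contMDiffAt hs ht).continuousAt.eventually (source_mem_nhds hx)
  have hcδ := (hδ.contMDiffAt hs' ht').continuousAt.eventually (source_mem_nhds hx')
  have hΩ : ((extChartAt I p).target ×ˢ Set.univ : Set (E × E)) ∈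
      nhds (extChartAt I p (γ t), deriv (extChartAt I p ∘ γ) t) :=
    ((isOpen_extChartAt_target p).prod isOpen_univ).mem_nhds
      ⟨extChartAt_mem_target hx, Set.mem_univ _⟩
  have key := eventuallyEq_of_hasDerivAt (f := geodesicField nabla p)
    (α := fun s ↦ ((extChartAt I p ∘ γ) s, deriv (extChartAt I p ∘ γ) s))
    (β := fun s ↦ ((extChartAt I p ∘ δ) s, deriv (extChartAt I p ∘ δ) s))
    (((contDiffOn_geodesicField (hΓ p)).contDiffAt hΩ).of_le ENat.LEInfty.out)
    (by filter_upwards [hcγ, hs.mem_nhds ht] with r hr hr' using hγ.hasDerivAt hs hr' hr)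
    (by filter_upwards [hcδ, hs'.mem_nhds ht'] with r hr hr' using hδ.hasDerivAt hs' hr' hr)
    (by simp only [h1, Function.comp_apply, h0])
  filter_upwards [key, hcγ, hcδ] with r hr h2 h3
  have h4 : extChartAt I p (γ r) = extChartAt I p (δ r) := congrArg Prod.fst hr
  rw [← extChartAt_symm_extChartAt (I := I) h2, h4, extChartAt_symm_extChartAt h3]

lemma IsGeodesicOn.eqOn [T2Space M] {nabla : Connection I M}
    (hΓ : ∀ p, ContDiffOn ℝ ∞ (christoffelCoord nabla p) (extChartAt I p).target)
    {γ δ : ℝ → M} {s : Set ℝ} (hγ : IsGeodesicOn nabla γ s) (hδ : IsGeodesicOn nabla δ s)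
    (hs : IsOpen s) (hs' : IsPreconnected s) {t : ℝ} (ht : t ∈ s) (h : γ =ᶠ[nhds t] δ) :
    Set.EqOn γ δ s := by
  have key : s ⊆ {r | γ =ᶠ[nhds r] δ} := by
    refine hs'.subset_of_closure_inter_subset isOpen_setOfPred_eventually_nhds ⟨t, ht, h⟩ ?_
    rintro r ⟨hr, hrs⟩
    have hf : ∃ᶠ q in nhds r, γ =ᶠ[nhds q] δ := mem_closure_iff_frequently.1 hr
    have hcγ := hγ.contMDiffAt hs hrs
    have hcδ := hδ.contMDiffAt hs hrs
    have h0 : γ r = δ r := by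
      by_contra hne
      refine hf ?_
      filter_upwards [(hcγ.continuousAt.ne_iff_eventually_ne hcδ.continuousAt).1 hne] with q hq hq'
      exact hq hq'.self_of_nhds
    have hx : γ r ∈ (chartAt H (γ r)).source := mem_chart_source H _
    have hx' : δ r ∈ (chartAt H (γ r)).source := h0 ▸ hx
    refine hγ.eventuallyEq hΓ hδ hs hs hrs hrs hx h0 ?_
    by_contra hne
    have c1 := (contDiffAt_extChartAt_comp hcγ hx).derivWithin (m := 1) (by norm_num)
    have c2 := (contDiffAt_extChartAt_comp hcδ hx').derivWithin (m := 1) (by norm_num)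
    refine hf ?_
    filter_upwards [(c1.continuousAt.ne_iff_eventually_ne c2.continuousAt).1 hne] with q hq hq'
    refine hq (Filter.EventuallyEq.deriv_eq ?_)
    exact hq'.mono fun s hs ↦ congrArg (extChartAt I (γ r)) hs
  exact fun r hr ↦ (key hr).self_of_nhds

omit [I.Boundaryless] in
/-- Geodesics that agree on the intersections of their domains can be glued. -/
lemma exists_isGeodesicOn_iUnion [Nonempty M] {nabla : Connection I M} {ι : Type*} {s : ι → Set ℝ}
    {γ : ι → ℝ → M} (hs : ∀ i, IsOpen (s i)) (hγ : ∀ i, IsGeodesicOn nabla (γ i) (s i))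
    (h : ∀ i j, Set.EqOn (γ i) (γ j) (s i ∩ s j)) :
    ∃ δ : ℝ → M, IsGeodesicOn nabla δ (⋃ i, s i) ∧ ∀ i, Set.EqOn δ (γ i) (s i) := by
  classical
  let δ (t : ℝ) : M := if ht : ∃ i, t ∈ s i then γ ht.choose t else Classical.arbitrary M
  have hδ (i : ι) : Set.EqOn δ (γ i) (s i) := fun t ht ↦ by
    have ht' : ∃ i, t ∈ s i := ⟨i, ht⟩
    simp only [δ, dif_pos ht']
    exact h _ _ ⟨ht'.choose_spec, ht⟩
  refine ⟨δ, isGeodesicOn_of_forall_exists fun t ht ↦ ?_, hδ⟩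
  obtain ⟨i, hi⟩ := Set.mem_iUnion.1 ht
  exact ⟨γ i, s i, hs i, hi, hγ i, hδ i⟩

end Geodesics

section Completeness

open Metric

set_option synthInstance.maxHeartbeats 200000 in
lemma exists_eventually_norm_sq_le {X V : Type*} [TopologicalSpace X] [NormedAddCommGroup V]
    [NormedSpace ℝ V] [FiniteDimensional ℝ V] {G : X → V →L[ℝ] V →L[ℝ] ℝ} {x₀ : X}
    (hG : ContinuousAt G x₀) (hpos : ∀ a, a ≠ 0 → 0 < G x₀ a a) :
    ∃ c, ∀ᶠ x in nhds x₀, ∀ a, ‖a‖ ^ 2 ≤ c * G x a a := by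
  obtain ⟨m, hm, h⟩ := (isCompact_sphere (0 : V) 1).exists_forall_le' (a := 0)
    (f := fun a ↦ G x₀ a a) (by fun_prop) fun a ha ↦ hpos a fun h0 ↦ by simp [h0] at ha
  have hG₀ (a : V) : m * ‖a‖ ^ 2 ≤ G x₀ a a := by
    obtain rfl | ha := eq_or_ne a 0
    · simp
    have ha' : ‖a‖ ≠ 0 := norm_ne_zero_iff.2 ha
    have h1 := h (‖a‖⁻¹ • a) (by simp [norm_smul, ha'])
    simp only [map_smul, smul_apply, smul_eq_mul] at h1
    have h2 := mul_le_mul_of_nonneg_right h1 (sq_nonneg ‖a‖)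
    refine h2.trans_eq ?_
    field_simp
  refine ⟨2 / m, ?_⟩
  filter_upwards [hG.eventually (eventually_norm_sub_lt (G x₀) (half_pos hm))] with x hx a
  have h1 : |(G x - G x₀) a a| ≤ m / 2 * ‖a‖ ^ 2 := by
    refine ((G x - G x₀).le_opNorm₂ a a).trans ?_
    rw [mul_assoc, ← sq]
    gcongr
  have h2 : (G x - G x₀) a a = G x a a - G x₀ a a := rfl
  rw [h2] at h1
  have h3 := (abs_le.1 h1).1
  have h4 := hG₀ a
  rw [div_mul_eq_mul_div, le_div_iff₀ hm]
  linarith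

set_option synthInstance.maxHeartbeats 200000 in
lemma hasDerivAt_bilinear_apply {V W : Type*} [NormedAddCommGroup V] [NormedSpace ℝ V]
    [NormedAddCommGroup W] [NormedSpace ℝ W] {G : V → V →L[ℝ] V →L[ℝ] W} {u v : ℝ → V} {u' v' : V}
    {t : ℝ} (hG : DifferentiableAt ℝ G (u t)) (hu : HasDerivAt u u' t) (hv : HasDerivAt v v' t) :
    HasDerivAt (fun r ↦ G (u r) (v r) (v r))
      (fderiv ℝ G (u t) u' (v t) (v t) + G (u t) v' (v t) + G (u t) (v t) v') t := by
  have h1 : HasDerivAt (fun r ↦ G (u r)) (fderiv ℝ G (u t) u') t :=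
    HasFDerivAt.comp_hasDerivAt (E := V →L[ℝ] V →L[ℝ] W) t hG.hasFDerivAt hu
  have h2 : HasDerivAt (fun r ↦ G (u r) (v r)) (fderiv ℝ G (u t) u' (v t) + G (u t) v') t :=
    h1.clm_apply hv
  exact h2.clm_apply hv

variable {E : Type*} [NormedAddCommGroup E] [NormedSpace ℝ E] [FiniteDimensional ℝ E]
  {H : Type*} [TopologicalSpace H] {I : ModelWithCorners ℝ E H} [I.Boundaryless]
  {M : Type*} [TopologicalSpace M] [ChartedSpace H M] [IsManifold I ∞ M]
  [RiemannianBundle (fun x : M ↦ TangentSpace I x)]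
  [IsContMDiffRiemannianBundle I ∞ E (fun x : M ↦ TangentSpace I x)]

lemma exists_eventually_norm_coord_sq_le (p : M) :
    ∃ c, ∀ᶠ x in nhds p, ∀ u : TangentSpace I x, ‖coord I p x u‖ ^ 2 ≤ c * inner ℝ u u := by
  have hp := mem_chart_source H p
  have hc : ContinuousAt (fun x ↦ metricCoord I p (extChartAt I p x)) p :=
    ((contDiffOn_metricCoord p).continuousOn.continuousAt
      ((isOpen_extChartAt_target p).mem_nhds (mem_extChartAt_target p))).comp
      (continuousAt_extChartAt p)
  obtain ⟨c, h⟩ := exists_eventually_norm_sq_le hc fun a ha ↦ by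
    rw [metricCoord_apply]
    refine real_inner_self_pos.2 fun h0 ↦ ha ?_
    rw [extChartAt_symm_extChartAt hp] at h0
    rw [← coord_ofCoord (I := I) hp a, h0, map_zero]
  refine ⟨c, ?_⟩
  filter_upwards [h, source_mem_nhds hp] with x hx hx' u
  rw [inner_eq_metricCoord hx']
  exact hx _

lemma exists_eventually_extend_geodesic {nabla : Connection I M}
    (hΓ : ∀ p, ContDiffOn ℝ ∞ (christoffelCoord nabla p) (extChartAt I p).target) (C : ℝ) (p : M) :
    ∃ ε > (0 : ℝ), ∀ᶠ x in nhds p, ∀ (γ : ℝ → M) (s : Set ℝ) (t : ℝ), IsGeodesicOn nabla γ s →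
      IsOpen s → t ∈ s → γ t = x → inner ℝ (velocity I γ t) (velocity I γ t) ≤ C →
      ∃ β : ℝ → M, IsGeodesicOn nabla β (Set.Ioo (t - ε) (t + ε)) ∧ β =ᶠ[nhds t] γ := by
  have hp := mem_chart_source H p
  obtain ⟨c, hc⟩ := exists_eventually_norm_coord_sq_le (I := I) p
  obtain ⟨r, hr, hr'⟩ := Metric.nhds_basis_closedBall.mem_iff.1
    ((isOpen_extChartAt_target (I := I) p).mem_nhds (mem_extChartAt_target p))
  obtain ⟨ε, hε, h⟩ := exists_forall_mem_isCompact_hasDerivAt (f := geodesicField nabla p)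
    ((isOpen_extChartAt_target (I := I) p).prod isOpen_univ)
    ((contDiffOn_geodesicField (hΓ p)).of_le ENat.LEInfty.out)
    ((isCompact_closedBall (extChartAt I p p) r).prod
      (isCompact_closedBall (0 : E) √(|c| * |C|)))
    (Set.prod_mono hr' (Set.subset_univ _))
  refine ⟨ε, hε, ?_⟩
  filter_upwards [hc, source_mem_nhds hp,
    (continuousAt_extChartAt (I := I) p).eventually (closedBall_mem_nhds _ hr)]
    with x hx hx1 hx2 γ s t hγ hs ht htx hC
  subst htx
  have hγt := hγ.contMDiffAt hs ht
  have hv := coord_velocity hx1 (hγt.mdifferentiableAt (by simp))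
  obtain ⟨α, hα0, hα⟩ := h (extChartAt I p (γ t), deriv (extChartAt I p ∘ γ) t) ⟨hx2, by
    rw [mem_closedBall_zero_iff, ← abs_norm]
    refine Real.abs_le_sqrt ?_
    rw [← hv]
    have h0 : 0 ≤ (inner ℝ (velocity I γ t) (velocity I γ t) : ℝ) := real_inner_self_nonneg
    calc _ ≤ c * inner ℝ (velocity I γ t) (velocity I γ t) := hx _
      _ ≤ |c| * |C| := mul_le_mul (le_abs_self c) (hC.trans (le_abs_self C)) h0 (abs_nonneg c)⟩
  have hmem {r : ℝ} (hr : r ∈ Set.Ioo (t - ε) (t + ε)) : r - t ∈ Set.Ioo (-ε) ε :=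
    ⟨by linarith [hr.1], by linarith [hr.2]⟩
  have hα' : ∀ r ∈ Set.Ioo (t - ε) (t + ε), (α (r - t)).1 ∈ (extChartAt I p).target ∧
      HasDerivAt (fun r ↦ α (r - t)) (geodesicField nabla p (α (r - t))) r := fun r hr ↦
    ⟨(hα _ (hmem hr)).1.1, (hα _ (hmem hr)).2.comp_sub_const r t⟩
  have hβ := isGeodesicOn_of_hasDerivAt (hΓ p) isOpen_Ioo hα'
  have htε : t ∈ Set.Ioo (t - ε) (t + ε) := ⟨by linarith, by linarith⟩
  have h0 : (extChartAt I p).symm (α (t - t)).1 = γ t := by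
    rw [sub_self, hα0]
    exact extChartAt_symm_extChartAt hx1
  refine ⟨_, hβ, hβ.eventuallyEq hΓ hγ isOpen_Ioo hs htε ht (p := p) ?_ h0 ?_⟩
  · rwa [h0]
  · have e : (extChartAt I p ∘ fun r ↦ (extChartAt I p).symm (α (r - t)).1) =ᶠ[nhds t]
        fun r ↦ (α (r - t)).1 := by
      filter_upwards [isOpen_Ioo.mem_nhds htε] with r hr
      exact (extChartAt I p).right_inv (hα' r hr).1
    have hd : HasDerivAt (fun r ↦ (α (r - t)).1) (geodesicField nabla p (α (t - t))).1 t :=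
      (hasFDerivAt_fst.comp_hasDerivAt t (hα' t htε).2 :)
    rw [e.deriv_eq, hd.deriv, sub_self, hα0]
    rfl

/-- On a compact manifold, geodesics of bounded speed extend by a uniform amount of time. -/
lemma exists_forall_extend_geodesic [CompactSpace M] {nabla : Connection I M}
    (hΓ : ∀ p, ContDiffOn ℝ ∞ (christoffelCoord nabla p) (extChartAt I p).target) (C : ℝ) :
    ∃ ε > (0 : ℝ), ∀ (γ : ℝ → M) (s : Set ℝ) (t : ℝ), IsGeodesicOn nabla γ s →
      IsOpen s → t ∈ s → inner ℝ (velocity I γ t) (velocity I γ t) ≤ C →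
      ∃ β : ℝ → M, IsGeodesicOn nabla β (Set.Ioo (t - ε) (t + ε)) ∧ β =ᶠ[nhds t] γ := by
  have key := isCompact_univ.induction_on (p := fun K : Set M ↦
    ∃ ε > (0 : ℝ), ∀ x ∈ K, ∀ (γ : ℝ → M) (s : Set ℝ) (t : ℝ), IsGeodesicOn nabla γ s →
      IsOpen s → t ∈ s → γ t = x → inner ℝ (velocity I γ t) (velocity I γ t) ≤ C →
      ∃ β : ℝ → M, IsGeodesicOn nabla β (Set.Ioo (t - ε) (t + ε)) ∧ β =ᶠ[nhds t] γ) ?_ ?_ ?_ ?_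
  · obtain ⟨ε, hε, h⟩ := key
    exact ⟨ε, hε, fun γ s t h1 h2 h3 ↦ h _ (Set.mem_univ _) γ s t h1 h2 h3 rfl⟩
  · exact ⟨1, one_pos, fun x hx ↦ hx.elim⟩
  · rintro s t hst ⟨ε, hε, h⟩
    exact ⟨ε, hε, fun x hx ↦ h x (hst hx)⟩
  · rintro K K' ⟨ε, hε, h⟩ ⟨ε', hε', h'⟩
    refine ⟨min ε ε', lt_min hε hε', ?_⟩
    rintro x (hx | hx) γ s t h1 h2 h3 h4 h5
    · obtain ⟨β, hβ, e⟩ := h x hx γ s t h1 h2 h3 h4 h5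
      exact ⟨β, hβ.mono (Set.Ioo_subset_Ioo (by linarith [min_le_left ε ε'])
        (by linarith [min_le_left ε ε'])), e⟩
    · obtain ⟨β, hβ, e⟩ := h' x hx γ s t h1 h2 h3 h4 h5
      exact ⟨β, hβ.mono (Set.Ioo_subset_Ioo (by linarith [min_le_right ε ε'])
        (by linarith [min_le_right ε ε'])), e⟩
  · intro p _
    obtain ⟨ε, hε, h⟩ := exists_eventually_extend_geodesic hΓ C p
    exact ⟨_, mem_nhdsWithin_of_mem_nhds h, ε, hε, fun y hy ↦ hy⟩

set_option synthInstance.maxHeartbeats 200000 in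
lemma IsGeodesicOn.hasDerivAt_inner_velocity {nabla : Connection I M} {γ : ℝ → M} {s : Set ℝ}
    (h : IsGeodesicOn nabla γ s) (hs : IsOpen s) {t : ℝ} (ht : t ∈ s) :
    HasDerivAt (fun r ↦ (inner ℝ (velocity I γ r) (velocity I γ r) : ℝ))
      (nablaMetric nabla (γ t) (velocity I γ t) (velocity I γ t) (velocity I γ t)) t := by
  set p := γ t with hp
  have hx : γ t ∈ (chartAt H p).source := mem_chart_source H _
  have hγ := h.contMDiffAt hs ht
  have hz := h.hasDerivAt hs ht hx
  have hu : HasDerivAt (extChartAt I p ∘ γ) (deriv (extChartAt I p ∘ γ) t) t :=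
    (hasFDerivAt_fst.comp_hasDerivAt t hz :)
  have hu' : HasDerivAt (deriv (extChartAt I p ∘ γ))
      (-christoffelCoord nabla p (extChartAt I p (γ t)) (deriv (extChartAt I p ∘ γ) t)
        (deriv (extChartAt I p ∘ γ) t)) t :=
    (hasFDerivAt_snd.comp_hasDerivAt t hz :)
  have hG : DifferentiableAt ℝ (metricCoord I p) ((extChartAt I p ∘ γ) t) :=
    ((contDiffOn_metricCoord p).contDiffAt
      ((isOpen_extChartAt_target p).mem_nhds (extChartAt_mem_target hx))).differentiableAt (by simp)
  have e : (fun r ↦ (inner ℝ (velocity I γ r) (velocity I γ r) : ℝ)) =ᶠ[nhds t] fun r ↦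
      metricCoord I p ((extChartAt I p ∘ γ) r) (deriv (extChartAt I p ∘ γ) r)
        (deriv (extChartAt I p ∘ γ) r) := by
    filter_upwards [coord_velocity_eventuallyEq hγ hx,
      hγ.continuousAt.eventually (source_mem_nhds hx)] with r hr hr'
    rw [inner_eq_metricCoord hr', hr]
    rfl
  refine ((hasDerivAt_bilinear_apply hG hu hu').congr_of_eventuallyEq e).congr_deriv ?_
  have h1 := nablaMetric_eq nabla hx (velocity I γ t) (velocity I γ t) (velocity I γ t)
  rw [coord_velocity hx (hγ.mdifferentiableAt (by simp))] at h1
  rw [h1]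
  simp only [map_neg, neg_apply, Function.comp_apply]
  ring

/-- The quantity `exp (2 * σ) * g(γ', γ')` is constant along geodesics. -/
lemma HasCubicForm.hasDerivAt_exp_mul_inner_velocity {nabla : Connection I M} {σ : M → ℝ}
    (hσ : ContMDiff I 𝓘(ℝ) ∞ σ) (h : HasCubicForm nabla (symDerivMetric σ)) {γ : ℝ → M} {s : Set ℝ}
    (hγ : IsGeodesicOn nabla γ s) (hs : IsOpen s) {t : ℝ} (ht : t ∈ s) :
    HasDerivAt (fun r ↦ Real.exp (2 * σ (γ r)) * inner ℝ (velocity I γ r) (velocity I γ r))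
      0 t := by
  have h1 := hγ.hasDerivAt_inner_velocity hs ht
  rw [h.nablaMetric_self] at h1
  have h2 : HasDerivAt (fun r ↦ σ (γ r)) (d% σ (γ t) (velocity I γ t)) t :=
    hasDerivAt_comp_curve (hσ.mdifferentiable (by simp) _)
      ((hγ.contMDiffAt hs ht).mdifferentiableAt (by simp))
  refine ((h2.const_mul 2).exp.mul h1).congr_deriv ?_
  ring

lemma HasCubicForm.exists_inner_velocity_le [CompactSpace M] {nabla : Connection I M} {σ : M → ℝ}
    (hσ : ContMDiff I 𝓘(ℝ) ∞ σ) (h : HasCubicForm nabla (symDerivMetric σ)) {γ : ℝ → M} {s : Set ℝ}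
    (hγ : IsGeodesicOn nabla γ s) (hs : IsOpen s) (hs' : IsPreconnected s) :
    ∃ C, ∀ t ∈ s, inner ℝ (velocity I γ t) (velocity I γ t) ≤ C := by
  obtain rfl | ⟨t₀, ht₀⟩ := s.eq_empty_or_nonempty
  · exact ⟨0, fun t ht ↦ ht.elim⟩
  obtain ⟨m, hm⟩ := (isCompact_range hσ.continuous).bddBelow
  let e (r : ℝ) : ℝ := Real.exp (2 * σ (γ r)) * inner ℝ (velocity I γ r) (velocity I γ r)
  have he (t : ℝ) (ht : t ∈ s) : HasDerivAt e 0 t :=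
    h.hasDerivAt_exp_mul_inner_velocity hσ hγ hs ht
  refine ⟨Real.exp (-(2 * m)) * e t₀, fun t ht ↦ ?_⟩
  have h1 : e t₀ = e t := hs.is_const_of_deriv_eq_zero hs'
    (fun r hr ↦ (he r hr).differentiableAt.differentiableWithinAt) (fun r hr ↦ (he r hr).deriv)
    ht₀ ht
  have h2 : m ≤ σ (γ t) := hm ⟨γ t, rfl⟩
  have h3 : (0 : ℝ) ≤ inner ℝ (velocity I γ t) (velocity I γ t) := real_inner_self_nonneg
  rw [h1, ← mul_assoc, ← Real.exp_add]
  exact le_mul_of_one_le_left h3 (Real.one_le_exp (by linarith))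

/-- A connection with smooth Christoffel symbols is complete if its geodesics have bounded speed. -/
theorem isComplete_of_forall_exists_inner_velocity_le [T2Space M] [CompactSpace M]
    {nabla : Connection I M}
    (hΓ : ∀ p, ContDiffOn ℝ ∞ (christoffelCoord nabla p) (extChartAt I p).target)
    (hC : ∀ (γ : ℝ → M) (s : Set ℝ), IsGeodesicOn nabla γ s → IsOpen s → IsPreconnected s →
      ∃ C, ∀ t ∈ s, inner ℝ (velocity I γ t) (velocity I γ t) ≤ C) : IsComplete nabla := by
  rintro s γ hs hs' ⟨t₀, ht₀⟩ hγ
  have : Nonempty M := ⟨γ t₀⟩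
  let ι := {q : Set ℝ × (ℝ → M) // IsOpen q.1 ∧ q.1.OrdConnected ∧ t₀ ∈ q.1 ∧
    IsGeodesicOn nabla q.2 q.1 ∧ q.2 =ᶠ[nhds t₀] γ}
  have hagree (i j : ι) : Set.EqOn i.1.2 j.1.2 (i.1.1 ∩ j.1.1) := by
    obtain ⟨⟨u, α⟩, hu, hu', hut, hα, e⟩ := i
    obtain ⟨⟨v, β⟩, hv, hv', hvt, hβ, e'⟩ := j
    exact (hα.mono Set.inter_subset_left).eqOn hΓ (hβ.mono Set.inter_subset_right) (hu.inter hv)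
      (hu'.inter hv').isPreconnected ⟨hut, hvt⟩ (e.trans e'.symm)
  obtain ⟨δ, hδ, hδi⟩ := exists_isGeodesicOn_iUnion (fun i : ι ↦ i.2.1)
    (fun i ↦ i.2.2.2.2.1) hagree
  set S := ⋃ i : ι, i.1.1 with hS
  have hSo : IsOpen S := isOpen_iUnion fun i ↦ i.2.1
  have hSc : IsPreconnected S :=
    isPreconnected_iUnion ⟨t₀, Set.mem_iInter.2 fun i ↦ i.2.2.2.1⟩ fun i ↦ i.2.2.1.isPreconnected
  let i₀ : ι := ⟨(s, γ), hs, hs', ht₀, hγ, .rfl⟩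
  have hsS : s ⊆ S := Set.subset_iUnion (fun i : ι ↦ i.1.1) i₀
  have hδγ : Set.EqOn δ γ s := hδi i₀
  obtain ⟨C, hC⟩ := hC δ S hδ hSo hSc
  obtain ⟨ε, hε, hext⟩ := exists_forall_extend_geodesic hΓ C
  have hball (t : ℝ) (ht : t ∈ S) : Set.Ioo (t - ε) (t + ε) ⊆ S := by
    obtain ⟨β, hβ, e⟩ := hext δ S t hδ hSo ht (hC t ht)
    have htε : t ∈ Set.Ioo (t - ε) (t + ε) := ⟨by linarith, by linarith⟩
    have hagree' : Set.EqOn β δ (Set.Ioo (t - ε) (t + ε) ∩ S) :=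
      (hβ.mono Set.inter_subset_left).eqOn hΓ (hδ.mono Set.inter_subset_right)
        (isOpen_Ioo.inter hSo) (Set.ordConnected_Ioo.inter hSc.ordConnected).isPreconnected
        ⟨htε, ht⟩ e
    obtain ⟨η, hη, hηi⟩ := exists_isGeodesicOn_iUnion (nabla := nabla)
      (s := fun b : Bool ↦ cond b (Set.Ioo (t - ε) (t + ε)) S)
      (γ := fun b : Bool ↦ cond b β δ)
      (by rintro (_ | _) <;> simp [hSo, isOpen_Ioo]) (by rintro (_ | _) <;> simpa)
      (by
        rintro (_ | _) (_ | _)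
        · exact fun _ _ ↦ rfl
        · exact fun r hr ↦ (hagree' ⟨hr.2, hr.1⟩).symm
        · exact hagree'
        · exact fun _ _ ↦ rfl)
    have hη' : η =ᶠ[nhds t₀] γ := by
      filter_upwards [hSo.mem_nhds (hsS ht₀), hs.mem_nhds ht₀] with r hr hr'
      exact (hηi false hr).trans (hδγ hr')
    rw [← Set.union_eq_iUnion] at hη
    have hc : IsPreconnected (Set.Ioo (t - ε) (t + ε) ∪ S) :=
      isPreconnected_Ioo.union t htε ht hSc
    let i : ι := ⟨(Set.Ioo (t - ε) (t + ε) ∪ S, η), isOpen_Ioo.union hSo, hc.ordConnected,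
      Or.inr (hsS ht₀), hη, hη'⟩
    exact Set.subset_union_left.trans (Set.subset_iUnion (fun i : ι ↦ i.1.1) i)
  have hScl : IsClosed S := by
    refine isClosed_of_closure_subset fun t ht ↦ ?_
    obtain ⟨r, hr, hrt⟩ := Metric.mem_closure_iff.1 ht ε hε
    rw [Real.dist_eq, abs_lt] at hrt
    exact hball r hr ⟨by linarith [hrt.1], by linarith [hrt.2]⟩
  have hSu : S = Set.univ := IsClopen.eq_univ ⟨hScl, hSo⟩ ⟨t₀, hsS ht₀⟩
  exact ⟨δ, hSu ▸ hδ, hδγ⟩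

theorem HasCubicForm.isComplete [T2Space M] [CompactSpace M] {nabla : Connection I M} {σ : M → ℝ}
    (hσ : ContMDiff I 𝓘(ℝ) ∞ σ) (h : HasCubicForm nabla (symDerivMetric σ)) : IsComplete nabla :=
  isComplete_of_forall_exists_inner_velocity_le (h.contDiffOn_christoffelCoord hσ)
    fun _ _ hγ hs hs' ↦ h.exists_inner_velocity_le hσ hγ hs hs'

end Completeness

end StatisticalManifold

end

theorem corollary4p6 {E : Type*} [NormedAddCommGroup E] [NormedSpace ℝ E] [FiniteDimensional ℝ E]
    {H : Type*} [TopologicalSpace H] (I : ModelWithCorners ℝ E H) [I.Boundaryless]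
    {M : Type*} [TopologicalSpace M] [ChartedSpace H M] [IsManifold I ∞ M]
    [T2Space M] [CompactSpace M]
    [RiemannianBundle (fun x : M ↦ TangentSpace I x)]
    [IsContMDiffRiemannianBundle I ∞ E (fun x : M ↦ TangentSpace I x)]
    (σ : M → ℝ) (hσ : ContMDiff I 𝓘(ℝ) ∞ σ) :
    (∃ nabla : StatisticalManifold.Connection I M,
      StatisticalManifold.HasCubicForm nabla (StatisticalManifold.symDerivMetric σ)) ∧
    ∀ nabla : StatisticalManifold.Connection I M,
      StatisticalManifold.HasCubicForm nabla (StatisticalManifold.symDerivMetric σ) →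
        StatisticalManifold.IsStatistical nabla ∧
        StatisticalManifold.IsComplete nabla ∧
        (∃ nabla', StatisticalManifold.IsDual nabla nabla') ∧
        ∀ nabla', StatisticalManifold.IsDual nabla nabla' →
          StatisticalManifold.IsComplete nabla' :=
  ⟨StatisticalManifold.exists_hasCubicForm σ, fun _ h ↦ ⟨h.isStatistical hσ, h.isComplete hσ,
    h.exists_isDual, fun _ hd ↦ (h.dual hd).isComplete hσ.neg⟩⟩
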